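/- Let $(X_n)_{n\ge 0}$ be a strictly stationary sequence of real random variables (event magnitudes), let $0=T_0\le T_1\le T_2\le\dots$ be the occurrence times of the events, and suppose that the waiting times $W_n=T_n-T_{n-1}\ge 0$ ($n\ge1$) are i.i.d. and that the sequence $(W_n)_{n\ge1}$ is independent of $(X_n)_{n\ge0}$. Let $X$ have the common law of the $X_n$ and put $M_n=\max\{X_1,\dots,X_n\}$. Assume: (i) there are constants $a_n>0$, $d_n\in\mathbb R$ and the distribution function $\widetilde G$ of a non-degenerate law such that, with $\widetilde M_n$ the maximum of $n$ i.i.d. copies of $X$, $\lim_{n\to\infty}\mathbb P\big((\widetilde M_n-d_n)/a_n\le x\big)=\widetilde G(x)$ for all $x\in\mathbb R$, and, for a constant $\theta\in(0,1]$ (the extremal index), $\lim_{n\to\infty}\mathbb P\big((M_n-d_n)/a_n\le x\big)=\widetilde G(x)^{\theta}$ for all $x\in\mathbb R$; (ii) for some $\alpha\in(0,1)$ the tail $x\mapsto\mathbb P(W_1>x)$ is regularly varying with index $-\alpha$. Here a measurable function $f:(0,\infty)\to(0,\infty)$ is called regularly varying with index $\rho$ if $f(\lambda x)/f(x)\to\lambda^{\rho}$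 as $x\to\infty$ for every $\lambda>0$. Let $p(u)=\mathbb P(X>u)$, let $x_R=\sup\{x:\mathbb P(X\le x)<1\}\in(-\infty,\infty]$ be the right endpoint of the law of $X$, let $\tau(u)=\min\{k\ge1: X_k>u\}$, and let $T(u)=T_{\tau(u)}=\sum_{i=1}^{\tau(u)}W_i$ be the return time, considered conditionally on $X_0>u$. Given $X_0>u$, $\tau(u)$ is almost surely finite. There exists a regularly varying function $b$ with index $1/\alpha$ such that $(W_1+\dots+W_n)/b(n)$ converges in distribution to a nonnegative random variable $D_\alpha$ with $\mathbb E\,e^{-sD_\alpha}=e^{-s^{\alpha}}$ for all $s\ge0$, and for every such $b$ the conditional law of $$\frac{T(u)}{b(1/p(u))}\quad\text{given } X_0>u$$ converges weakly, as $u\uparrow x_R$, to the mixture $$(1-\theta)\,\varepsilon_0+\theta\cdot \mathrm{ML}(\alpha,\theta^{-1/\alpha}),$$ where $\varepsilon_0$ is the Dirac measure at $0$ and $\mathrm{ML}(\alpha,\sigma)$ is the law of $\sigma Y$ for a positive random variable $Y$ with Laplace transform $\mathbb E\,e^{-sY}=1/(1+s^{\alpha})$, $s\ge0$. -/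

import Mathlib

open MeasureTheory ProbabilityTheory Filter Topology

noncomputable section

namespace ReturnTimes

/-- `f : (0,∞) → (0,∞)` is a (Borel measurable) regularly varying function with index `ρ`:
`f (lam * x) / f x → lam ^ ρ` as `x → ∞`, for every `lam > 0`. Only the values of `f` on `(0,∞)`
matter. -/
structure RegularlyVarying (f : ℝ → ℝ) (ρ : ℝ) : Prop where
  measurable : Measurable fun x : Set.Ioi (0 : ℝ) => f x
  pos : ∀ x : ℝ, 0 < x → 0 < f x
  tendsto : ∀ lam : ℝ, 0 < lam → Tendsto (fun x => f (lam * x) / f x) atTop (𝓝 (lam ^ ρ))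

variable {Ω : Type*} [MeasurableSpace Ω]

/-- Strict stationarity of the sequence `X 0, X 1, …`: all shifted sequences have the same law. -/
def IsStrictlyStationary (X : ℕ → Ω → ℝ) (μ : Measure Ω) : Prop :=
  ∀ k : ℕ, IdentDistrib (fun ω n => X (n + k) ω) (fun ω n => X n ω) μ μ

/-- The maximum `M_n = max {X 1, …, X n}` (used for `n ≥ 1`). -/
def partialMax (X : ℕ → Ω → ℝ) (n : ℕ) (ω : Ω) : ℝ :=
  ⨆ i : Fin n, X (i + 1) ω

/-- The sequence `X 0, X 1, …`, whose terms have the common law of `X 0`, has extremal index `θ`: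
there are norming constants `a n > 0`, `d n` and a non-degenerate law `G` on the line such that the
normalized maximum of `n` i.i.d. copies of `X 0` has limiting distribution function `cdf G`
(max-domain of attraction), and the normalized maximum `M_n` of the sequence itself has limiting
distribution function `(cdf G) ^ θ`, with the same norming constants. -/
def HasExtremalIndex (X : ℕ → Ω → ℝ) (μ : Measure Ω) (θ : ℝ) : Prop :=
  ∃ (a d : ℕ → ℝ) (G : ProbabilityMeasure ℝ),
    (∀ n, 0 < a n) ∧
    (∀ c : ℝ, (G : Measure ℝ) ≠ Measure.dirac c) ∧
    (∀ x : ℝ, Tendsto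
      (fun n : ℕ => (Measure.pi fun _ : Fin n => μ.map (X 0)).real
        {y : Fin n → ℝ | ((⨆ i, y i) - d n) / a n ≤ x})
      atTop (𝓝 (cdf (G : Measure ℝ) x))) ∧
    (∀ x : ℝ, Tendsto
      (fun n : ℕ => μ.real {ω | (partialMax X n ω - d n) / a n ≤ x})
      atTop (𝓝 (cdf (G : Measure ℝ) x ^ θ)))

/-- The waiting time `T (n+1) - T n` between consecutive events. -/
def waitingTime (T : ℕ → Ω → ℝ) (n : ℕ) (ω : Ω) : ℝ :=
  T (n + 1) ω - T n ω

/-- The exceedance probability `p u = P (X 0 > u)`. -/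
def exceedProb (X : ℕ → Ω → ℝ) (μ : Measure Ω) (u : ℝ) : ℝ :=
  μ.real {ω | u < X 0 ω}

/-- The right endpoint `sup {x | P (X 0 ≤ x) < 1}` of the law of `X 0`, possibly `∞`. -/
def rightEndpoint (X : ℕ → Ω → ℝ) (μ : Measure Ω) : EReal :=
  sSup ((fun x : ℝ => (x : EReal)) '' {x : ℝ | μ.real {ω | X 0 ω ≤ x} < 1})

/-- The filter on the reals describing `u ↑ x`, for an extended real `x`. -/
def leftLimit (x : EReal) : Filter ℝ :=
  comap (fun u : ℝ => (u : EReal)) (𝓝[<] x)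

/-- The index `τ u = min {k ≥ 1 | X k > u}` of the first exceedance after time `0`
(with value `0` where there is no exceedance). -/
def firstExceedance (X : ℕ → Ω → ℝ) (u : ℝ) (ω : Ω) : ℕ :=
  sInf {k : ℕ | 1 ≤ k ∧ u < X k ω}

/-- The return time `T(u) = T_{τ(u)}`. -/
def returnTime (X T : ℕ → Ω → ℝ) (u : ℝ) (ω : Ω) : ℝ :=
  T (firstExceedance X u ω) ω

/-- The conditional law of `T(u) / c` given `X 0 > u` (a probability measure if
`P (X 0 > u) > 0`, and the zero measure otherwise). -/
def scaledReturnLaw (X T : ℕ → Ω → ℝ) (μ : Measure Ω) [IsFiniteMeasure μ] (u c : ℝ) :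
    FiniteMeasure ℝ :=
  ⟨(μ[|{ω | u < X 0 ω}]).map fun ω => returnTime X T u ω / c, inferInstance⟩

/-- The one-sided `α`-stable law on `[0,∞)` with Laplace transform `exp (-s ^ α)`. -/
def IsOneSidedStable (α : ℝ) (D : ProbabilityMeasure ℝ) : Prop :=
  (D : Measure ℝ) (Set.Iio 0) = 0 ∧
    ∀ s : ℝ, 0 ≤ s → ∫ x, Real.exp (-(s * x)) ∂(D : Measure ℝ) = Real.exp (-s ^ α)

/-- `b` is a norming function for the sums of `W 0, W 1, …`: it is regularly varying with index
`1/α`, and `(W 0 + … + W (n-1)) / b n` converges in distribution to the `α`-stable law with Laplace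
transform `exp (-s ^ α)`. -/
def IsStableNorming (W : ℕ → Ω → ℝ) (μ : Measure Ω) [IsProbabilityMeasure μ] (α : ℝ)
    (b : ℝ → ℝ) : Prop :=
  RegularlyVarying b (1 / α) ∧
    ∃ D : ProbabilityMeasure ℝ, IsOneSidedStable α D ∧
      TendstoInDistribution (fun (n : ℕ) ω => (∑ i ∈ Finset.range n, W i ω) / b n) atTop
        (id : ℝ → ℝ) (fun _ => μ) (D : Measure ℝ)

/-- `Q` is the Mittag-Leffler law `ML(β, σ)`: the law of `σ * Y` for a positive random variable `Y`
with Laplace transform `1 / (1 + s ^ β)`. -/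
def IsMittagLeffler (β σ : ℝ) (Q : ProbabilityMeasure ℝ) : Prop :=
  ∃ R : ProbabilityMeasure ℝ, (R : Measure ℝ) (Set.Iic 0) = 0 ∧
    (∀ s : ℝ, 0 ≤ s → ∫ y, Real.exp (-(s * y)) ∂(R : Measure ℝ) = 1 / (1 + s ^ β)) ∧
    (Q : Measure ℝ) = (R : Measure ℝ).map fun y => σ * y

/-- The mixture `(1 - θ) ε₀ + θ Q`, for `0 ≤ θ ≤ 1`. -/
def zeroMixture (θ : ℝ) (Q : ProbabilityMeasure ℝ) : FiniteMeasure ℝ :=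
  ⟨(1 - θ).toNNReal • Measure.dirac 0 + θ.toNNReal • (Q : Measure ℝ), inferInstance⟩

end ReturnTimes

end

/-!
Given `X 0 > u`, the return time is a sum of `τ` waiting times, where the number `τ` of summands
depends on the magnitudes only. With `z = E exp (-s W / b)` its Laplace transform at `s / b` is
therefore the generating function `E (z ^ τ | X 0 > u)`.

By stationarity the conditional law of `τ` is a discrete derivative of
`g k = P (X 1 ≤ u, …, X k ≤ u)`, namely `p P (τ > k | X 0 > u) = g k - g (k + 1)` with
`p = P (X 0 > u)` (`real_survivalSet`); as `g` converges, this also gives the finiteness of `τ`.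
Two summations by parts (`hasSum_generating`) turn the generating function into
`1 - (1 - z) / p * (1 - (1 - z) ∑ z ^ k g (k + 1))`.

The extremal index enters through `g ⌊t / p⌋ → exp (-θ t)` (`tendsto_noExceedProb`). The hypothesis
provides this only along the normalized levels `a n * x + d n`. It carries over to all levels since
the distribution function `G` has a dense range in `(0,1)`: convergence of types makes `G`
max-stable, so that its range is closed under powers and roots
(`exists_cdf_mem_Ioo_of_tendsto_pow`). Together with `(1 - z) / p → q`, where `q = s ^ α`, the Abel
means `(1 - z) ∑ z ^ k g (k + 1)` tend to
`∫ q exp (-q t) exp (-θ t) dt = q / (q + θ)` (`tendsto_abel_mean`), and the limit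
`1 - q (1 - q / (q + θ)) = (1 - θ) + θ / (1 + q / θ)` is the Laplace transform of the mixture.

The relation `(1 - z) / p → s ^ α` says that `x (1 - E exp (-s W / b x)) → s ^ α` as `x → ∞`. For
integers `x` it is equivalent to the convergence in law of `(W 1 + … + W n) / b n`; the passage to
real `x` uses the uniform convergence theorem for measurable regularly varying functions
(`RegularlyVarying.tendsto_div_natFloor`). A norming function is obtained by inverting
`1 - E exp (-s W)`, which is regularly varying at `0` by the Abelian half of Karamata's Tauberian
theorem (`tendsto_laplaceDefect_div_tail`). The stable law arises as a limit in the continuity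
theorem for Laplace transforms (`exists_tendsto_of_tendsto_laplace`), which follows from
Prokhorov's theorem.
-/

namespace ReturnTimes

/-! ### Laplace transforms of laws on the half-line -/

section

open scoped NNReal ENNReal BoundedContinuousFunction

/-- The Laplace transform `s ↦ ∫ exp (-s x) dν(x)` of a measure on the line. It is only used for
measures that do not charge the negative half-line, and for `s ≥ 0`. -/
noncomputable def laplace (ν : Measure ℝ) (s : ℝ) : ℝ := ∫ x, Real.exp (-(s * x)) ∂ν

/-- The function `x ↦ exp (-s max x 0)`, a bounded continuous extension to the whole line of the
kernel of the Laplace transform. -/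
noncomputable def expKernel (s : ℝ) (hs : 0 ≤ s) : ℝ →ᵇ ℝ :=
  BoundedContinuousFunction.ofNormedAddCommGroup (fun x => Real.exp (-(s * max x 0)))
    (by fun_prop) 1 fun x => by
      rw [Real.norm_eq_abs, abs_of_pos (Real.exp_pos _), Real.exp_le_one_iff]
      have : 0 ≤ s * max x 0 := by positivity
      linarith

lemma ae_nonneg_of_measure_Iio {ν : Measure ℝ} (h : ν (Set.Iio 0) = 0) : ∀ᵐ x ∂ν, 0 ≤ x := by
  rw [ae_iff]; convert h using 2; ext x; simp

lemma measure_Iio_of_ae_nonneg {ν : Measure ℝ} (h : ∀ᵐ x ∂ν, 0 ≤ x) : ν (Set.Iio 0) = 0 := by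
  rw [ae_iff] at h; convert h using 2; ext x; simp

lemma laplace_eq_integral_expKernel {ν : Measure ℝ} (h : ν (Set.Iio 0) = 0) {s : ℝ} (hs : 0 ≤ s) :
    laplace ν s = ∫ x, expKernel s hs x ∂ν := by
  refine integral_congr_ae ?_
  filter_upwards [ae_nonneg_of_measure_Iio h] with x hx
  simp [expKernel, max_eq_left hx]

lemma integrable_exp_neg {ν : Measure ℝ} [IsFiniteMeasure ν] (h : ν (Set.Iio 0) = 0) {s : ℝ}
    (hs : 0 ≤ s) : Integrable (fun x => Real.exp (-(s * x))) ν := by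
  refine ((expKernel s hs).integrable ν).congr ?_
  filter_upwards [ae_nonneg_of_measure_Iio h] with x hx
  simp [expKernel, max_eq_left hx]

lemma laplace_zero (ν : Measure ℝ) [IsProbabilityMeasure ν] : laplace ν 0 = 1 := by
  simp [laplace]

/-- The function `x ↦ exp (-x)` on the half-line. -/
noncomputable def expNegNNReal : ℝ≥0 →ᵇ ℝ :=
  BoundedContinuousFunction.ofNormedAddCommGroup (fun x : ℝ≥0 => Real.exp (-(x : ℝ)))
    (by fun_prop) 1 fun x => by
      rw [Real.norm_eq_abs, abs_of_pos (Real.exp_pos _), Real.exp_le_one_iff]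
      simp

/-- The algebra of polynomials in `exp (-x)` on the half-line. -/
noncomputable def expAlgebra : StarSubalgebra ℝ (ℝ≥0 →ᵇ ℝ) :=
  { (Polynomial.aeval expNegNNReal : Polynomial ℝ →ₐ[ℝ] (ℝ≥0 →ᵇ ℝ)).range with
    star_mem' := by
      intro f hf
      have : star f = f := by ext; simp
      simpa [this] using hf }

/-- A finite measure on `[0,∞)` is determined by its Laplace transform, even by the values at the
integers: the powers of `exp (-x)` span an algebra that separates points. -/
theorem eq_of_laplace_eq {μ ν : Measure ℝ} [IsFiniteMeasure μ] [IsFiniteMeasure ν]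
    (hμ : μ (Set.Iio 0) = 0) (hν : ν (Set.Iio 0) = 0)
    (h : ∀ n : ℕ, laplace μ n = laplace ν n) : μ = ν := by
  have key : ∀ κ : Measure ℝ, κ (Set.Iio 0) = 0 →
      (κ.map Real.toNNReal).map ((↑) : ℝ≥0 → ℝ) = κ := by
    intro κ hκ
    rw [Measure.map_map (by fun_prop) (by fun_prop)]
    conv_rhs => rw [← Measure.map_id (μ := κ)]
    refine Measure.map_congr ?_
    filter_upwards [ae_nonneg_of_measure_Iio hκ] with x hx
    simp [hx]
  have hpow : ∀ κ : Measure ℝ, κ (Set.Iio 0) = 0 → ∀ n : ℕ,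
      ∫ x, (expNegNNReal ^ n : ℝ≥0 →ᵇ ℝ) x ∂(κ.map Real.toNNReal) = laplace κ n := by
    intro κ hκ n
    rw [integral_map (by fun_prop)
      (expNegNNReal ^ n : ℝ≥0 →ᵇ ℝ).continuous.measurable.aestronglyMeasurable]
    refine integral_congr_ae ?_
    filter_upwards [ae_nonneg_of_measure_Iio hκ] with x hx
    simp [expNegNNReal, hx, ← Real.exp_nat_mul]
  rw [← key μ hμ, ← key ν hν]
  congr 1
  have : IsFiniteMeasure (μ.map Real.toNNReal) := inferInstance
  refine ext_of_forall_mem_subalgebra_integral_eq_of_polish (𝕜 := ℝ) (A := expAlgebra) ?_ ?_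
  · intro x y hxy
    refine ⟨fun x : ℝ≥0 => Real.exp (-(x : ℝ)), ?_, ?_⟩
    · refine ⟨_, ⟨expNegNNReal, ?_, rfl⟩, rfl⟩
      exact ⟨Polynomial.X, by simp⟩
    · simpa using hxy
  · rintro _ ⟨p, rfl⟩
    have hint : ∀ κ : Measure ℝ, [IsFiniteMeasure κ] → κ (Set.Iio 0) = 0 →
        ∫ x, (Polynomial.aeval expNegNNReal p : ℝ≥0 →ᵇ ℝ) x ∂(κ.map Real.toNNReal)
          = ∑ i ∈ Finset.range (p.natDegree + 1), p.coeff i * laplace κ i := by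
      intro κ _ hκ
      simp_rw [Polynomial.aeval_eq_sum_range, ← hpow κ hκ]
      simp only [BoundedContinuousFunction.coe_sum, Finset.sum_apply,
        BoundedContinuousFunction.coe_smul, smul_eq_mul]
      rw [integral_finsetSum]
      · simp_rw [integral_const_mul]
      · intro i _
        exact (BoundedContinuousFunction.integrable _ (expNegNNReal ^ i : ℝ≥0 →ᵇ ℝ)).const_mul _
    refine (hint μ hμ).trans (Eq.trans ?_ (hint ν hν).symm)
    simp_rw [h]

/-- Tail estimate behind the continuity theorem: Markov's inequality for `1 - exp (-x / r)`. -/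
lemma measure_norm_gt_le_laplace {ν : Measure ℝ} [IsProbabilityMeasure ν]
    (h : ν (Set.Iio 0) = 0) {r : ℝ} (hr : 0 < r) :
    ν {x | r < ‖x‖} ≤
      ENNReal.ofReal ((1 - laplace ν (1 / r)) / (1 - Real.exp (-1))) := by
  have he : 0 < 1 - Real.exp (-1) := by
    have : Real.exp (-1) < 1 := Real.exp_lt_one_iff.2 (by norm_num)
    linarith
  have hr' : 0 ≤ 1 / r := by positivity
  have hint := integrable_exp_neg h hr'
  have h1 : (1 - Real.exp (-1)) * ν.real {x | (1 - Real.exp (-1)) ≤ 1 - Real.exp (-(1 / r * x))}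
      ≤ ∫ x, (1 - Real.exp (-(1 / r * x))) ∂ν := by
    refine mul_meas_ge_le_integral_of_nonneg ?_ ((integrable_const _).sub hint) _
    filter_upwards [ae_nonneg_of_measure_Iio h] with x hx
    have : Real.exp (-(1 / r * x)) ≤ 1 := by
      rw [Real.exp_le_one_iff]
      have : 0 ≤ 1 / r * x := by positivity
      linarith
    simpa using this
  rw [integral_sub (integrable_const _) hint] at h1
  simp only [integral_const, probReal_univ, smul_eq_mul, one_mul] at h1
  have h2 : ν {x | r < ‖x‖} ≤ ν {x | (1 - Real.exp (-1)) ≤ 1 - Real.exp (-(1 / r * x))} := by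
    refine measure_mono_ae ?_
    filter_upwards [ae_nonneg_of_measure_Iio h] with x hx hx'
    have hx'' : r < x := by
      have : r < ‖x‖ := hx'
      rwa [Real.norm_of_nonneg hx] at this
    change (1 - Real.exp (-1)) ≤ 1 - Real.exp (-(1 / r * x))
    have : 1 ≤ 1 / r * x := by
      rw [one_div, ← div_eq_inv_mul, le_div_iff₀ hr]; linarith
    have := Real.exp_le_exp.2 (neg_le_neg this)
    linarith
  refine h2.trans ?_
  rw [← ofReal_measureReal]
  refine ENNReal.ofReal_le_ofReal ?_
  rw [le_div_iff₀ he, mul_comm]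
  exact h1

lemma isTightMeasureSet_of_tendsto_laplace {ν : ℕ → Measure ℝ}
    [∀ n, IsProbabilityMeasure (ν n)] {L : ℝ → ℝ}
    (h0 : ∀ n, ν n (Set.Iio 0) = 0)
    (hL : ∀ s, 0 < s → Tendsto (fun n => laplace (ν n) s) atTop (𝓝 (L s)))
    (hL1 : Tendsto L (𝓝[>] 0) (𝓝 1)) : IsTightMeasureSet (Set.range ν) := by
  refine isTightMeasureSet_range_of_tendsto_limsup_measure_norm_gt ?_
  have hb : Tendsto (fun r : ℝ => ENNReal.ofReal ((1 - L (1 / r)) / (1 - Real.exp (-1)))) atTop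
      (𝓝 0) := by
    have h1 : Tendsto (fun r : ℝ => 1 / r) atTop (𝓝[>] 0) := by
      simpa using tendsto_inv_atTop_nhdsGT_zero (𝕜 := ℝ)
    have h2 := ((tendsto_const_nhds (x := (1 : ℝ))).sub (hL1.comp h1)).div_const
      (1 - Real.exp (-1))
    simpa using ENNReal.tendsto_ofReal h2
  refine tendsto_of_tendsto_of_tendsto_of_le_of_le' tendsto_const_nhds hb
    (Eventually.of_forall fun r => zero_le) ?_
  filter_upwards [eventually_gt_atTop 0] with r hr
  have h3 : Tendsto (fun n => ENNReal.ofReal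
      ((1 - laplace (ν n) (1 / r)) / (1 - Real.exp (-1)))) atTop
      (𝓝 (ENNReal.ofReal ((1 - L (1 / r)) / (1 - Real.exp (-1))))) :=
    ENNReal.tendsto_ofReal ((tendsto_const_nhds.sub (hL _ (by positivity))).div_const _)
  rw [← h3.limsup_eq]
  exact limsup_le_limsup (Eventually.of_forall fun n => measure_norm_gt_le_laplace (h0 n) hr)

lemma measure_Iio_eq_zero_of_tendsto {ι : Type*} {l : Filter ι} [l.NeBot]
    {ν : ι → ProbabilityMeasure ℝ} {ν₀ : ProbabilityMeasure ℝ} (h : Tendsto ν l (𝓝 ν₀))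
    (h0 : ∀ n, (ν n : Measure ℝ) (Set.Iio 0) = 0) : (ν₀ : Measure ℝ) (Set.Iio 0) = 0 := by
  have := ProbabilityMeasure.le_liminf_measure_open_of_tendsto h (isOpen_Iio (a := (0 : ℝ)))
  simpa [h0] using this

lemma tendsto_laplace_of_tendsto {ι : Type*} {l : Filter ι} [l.NeBot]
    {ν : ι → ProbabilityMeasure ℝ} {ν₀ : ProbabilityMeasure ℝ} (h : Tendsto ν l (𝓝 ν₀))
    (h0 : ∀ n, (ν n : Measure ℝ) (Set.Iio 0) = 0) {s : ℝ} (hs : 0 ≤ s) :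
    Tendsto (fun n => laplace (ν n) s) l (𝓝 (laplace ν₀ s)) := by
  rw [laplace_eq_integral_expKernel (measure_Iio_eq_zero_of_tendsto h h0) hs]
  simp_rw [fun n => laplace_eq_integral_expKernel (h0 n) hs]
  exact ProbabilityMeasure.tendsto_iff_forall_integral_tendsto.1 h _

/-- **Continuity theorem** for Laplace transforms. If the Laplace transforms of probability
measures on `[0,∞)` converge to a function with limit `1` at `0`, then the measures converge weakly,
and the limit function is the Laplace transform of the limit. -/
theorem exists_tendsto_of_tendsto_laplace {ν : ℕ → ProbabilityMeasure ℝ} {L : ℝ → ℝ}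
    (h0 : ∀ n, (ν n : Measure ℝ) (Set.Iio 0) = 0)
    (hL : ∀ s, 0 < s → Tendsto (fun n => laplace (ν n) s) atTop (𝓝 (L s)))
    (hL1 : Tendsto L (𝓝[>] 0) (𝓝 1)) :
    ∃ ν₀ : ProbabilityMeasure ℝ, (ν₀ : Measure ℝ) (Set.Iio 0) = 0 ∧
      (∀ s, 0 < s → laplace ν₀ s = L s) ∧ Tendsto ν atTop (𝓝 ν₀) := by
  have htight := isTightMeasureSet_of_tendsto_laplace (ν := fun n => (ν n : Measure ℝ)) h0 hL hL1
  have hcomp : IsCompact (closure (Set.range ν)) := by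
    refine isCompact_closure_of_isTightMeasureSet (htight.subset ?_)
    rintro _ ⟨_, ⟨n, rfl⟩, rfl⟩
    exact ⟨n, rfl⟩
  have hU : ∀ U : Ultrafilter ℕ, (U : Filter ℕ) ≤ atTop → ∃ ν₀ : ProbabilityMeasure ℝ,
      (ν₀ : Measure ℝ) (Set.Iio 0) = 0 ∧ (∀ s, 0 < s → laplace ν₀ s = L s) ∧
        Tendsto ν U (𝓝 ν₀) := by
    intro U hU
    obtain ⟨ν₀, -, hν₀⟩ := hcomp.ultrafilter_le_nhds (U.map ν)
      (le_principal_iff.2 (mem_map.2 (Eventually.of_forall fun n => subset_closure ⟨n, rfl⟩)))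
    have hν₀' : Tendsto ν U (𝓝 ν₀) := hν₀
    refine ⟨ν₀, measure_Iio_eq_zero_of_tendsto hν₀' h0, fun s hs => ?_, hν₀'⟩
    exact tendsto_nhds_unique (tendsto_laplace_of_tendsto hν₀' h0 hs.le) ((hL s hs).mono_left hU)
  obtain ⟨ν₀, hν0, hνL, -⟩ := hU (Filter.hyperfilter ℕ) Nat.hyperfilter_le_atTop
  refine ⟨ν₀, hν0, hνL, (tendsto_iff_ultrafilter _ _ _).2 fun U hUle => ?_⟩
  obtain ⟨ν₁, hν10, hν1L, hν1⟩ := hU U hUle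
  have : ν₁ = ν₀ := by
    refine Subtype.ext (eq_of_laplace_eq (μ := (ν₁ : Measure ℝ)) (ν := (ν₀ : Measure ℝ))
      hν10 hν0 fun n => ?_)
    rcases Nat.eq_zero_or_pos n with rfl | hn
    · simp [laplace_zero]
    · rw [hν1L _ (by exact_mod_cast hn), hνL _ (by exact_mod_cast hn)]
  rw [← this]; exact hν1

theorem tendsto_of_tendsto_laplace {ν : ℕ → ProbabilityMeasure ℝ} {ν₀ : ProbabilityMeasure ℝ}
    (h0 : ∀ n, (ν n : Measure ℝ) (Set.Iio 0) = 0) (h0' : (ν₀ : Measure ℝ) (Set.Iio 0) = 0)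
    (hL : ∀ s, 0 < s → Tendsto (fun n => laplace (ν n) s) atTop (𝓝 (laplace ν₀ s))) :
    Tendsto ν atTop (𝓝 ν₀) := by
  have hcont : Tendsto (laplace ν₀) (𝓝[>] 0) (𝓝 1) := by
    rw [← laplace_zero (ν₀ : Measure ℝ)]
    refine tendsto_integral_filter_of_dominated_convergence (fun _ => 1) ?_ ?_
      (integrable_const _) ?_
    · exact Eventually.of_forall fun s => by fun_prop
    · filter_upwards [self_mem_nhdsWithin] with s hs
      filter_upwards [ae_nonneg_of_measure_Iio h0'] with x hx
      rw [Real.norm_eq_abs, abs_of_pos (Real.exp_pos _), Real.exp_le_one_iff]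
      have : 0 ≤ s * x := mul_nonneg (le_of_lt hs) hx
      linarith
    · refine Eventually.of_forall fun x => ?_
      refine tendsto_nhdsWithin_of_tendsto_nhds ?_
      exact Continuous.tendsto (by fun_prop) 0
  obtain ⟨ν₁, hν10, hν1L, hν1⟩ := exists_tendsto_of_tendsto_laplace h0 hL hcont
  have : ν₁ = ν₀ := by
    refine Subtype.ext (eq_of_laplace_eq (μ := (ν₁ : Measure ℝ)) (ν := (ν₀ : Measure ℝ))
      hν10 h0' fun n => ?_)
    rcases Nat.eq_zero_or_pos n with rfl | hn
    · simp [laplace_zero]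
    · rw [hν1L _ (by exact_mod_cast hn)]
  rw [← this]; exact hν1

end

/-! ### Laplace transforms of laws with a regularly varying tail -/

section

/-- The defect `1 - ∫ exp (-s x) dκ(x)` of the Laplace transform of a probability measure. -/
noncomputable def laplaceDefect (κ : Measure ℝ) (s : ℝ) : ℝ := 1 - laplace κ s

lemma laplaceDefect_zero (κ : Measure ℝ) [IsProbabilityMeasure κ] : laplaceDefect κ 0 = 0 := by
  simp [laplaceDefect, laplace_zero]

lemma laplace_nonneg (κ : Measure ℝ) (s : ℝ) : 0 ≤ laplace κ s :=
  integral_nonneg fun _ => (Real.exp_pos _).le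

lemma laplace_le_one {κ : Measure ℝ} [IsProbabilityMeasure κ] (h0 : κ (Set.Iio 0) = 0) {s : ℝ}
    (hs : 0 ≤ s) : laplace κ s ≤ 1 := by
  have : laplace κ s ≤ ∫ _, (1 : ℝ) ∂κ := by
    refine integral_mono_ae (integrable_exp_neg h0 hs) (integrable_const _) ?_
    filter_upwards [ae_nonneg_of_measure_Iio h0] with x hx
    have := mul_nonneg hs hx
    simpa using this
  simpa using this

lemma laplaceDefect_nonneg {κ : Measure ℝ} [IsProbabilityMeasure κ] (h0 : κ (Set.Iio 0) = 0)
    {s : ℝ} (hs : 0 ≤ s) : 0 ≤ laplaceDefect κ s := sub_nonneg.2 (laplace_le_one h0 hs)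

lemma strictMonoOn_laplaceDefect {κ : Measure ℝ} [IsProbabilityMeasure κ]
    (h0 : κ (Set.Iio 0) = 0) (hpos : 0 < κ.real (Set.Ioi 0)) :
    StrictMonoOn (laplaceDefect κ) (Set.Ici 0) := by
  intro s hs t ht hst
  have hs' : 0 ≤ s := hs
  have ht' : 0 ≤ t := ht
  have hi : Integrable (fun x => Real.exp (-(s * x)) - Real.exp (-(t * x))) κ :=
    (integrable_exp_neg h0 hs').sub (integrable_exp_neg h0 ht')
  have : 0 < ∫ x, (Real.exp (-(s * x)) - Real.exp (-(t * x))) ∂κ := by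
    rw [integral_pos_iff_support_of_nonneg_ae ?_ hi]
    · have hsub : Set.Ioi (0 : ℝ) ⊆
          Function.support fun x => Real.exp (-(s * x)) - Real.exp (-(t * x)) := by
        intro x hx
        have hx' : 0 < x := hx
        have : Real.exp (-(t * x)) < Real.exp (-(s * x)) :=
          Real.exp_lt_exp.2 (neg_lt_neg (mul_lt_mul_of_pos_right hst hx'))
        exact (sub_pos.2 this).ne'
      exact (ENNReal.toReal_pos_iff.1 hpos).1.trans_le (measure_mono hsub)
    · filter_upwards [ae_nonneg_of_measure_Iio h0] with x hx
      have : Real.exp (-(t * x)) ≤ Real.exp (-(s * x)) :=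
        Real.exp_le_exp.2 (neg_le_neg (mul_le_mul_of_nonneg_right hst.le hx))
      simpa using this
  rw [integral_sub (integrable_exp_neg h0 hs') (integrable_exp_neg h0 ht')] at this
  simp only [laplaceDefect, laplace]
  linarith

lemma continuousOn_laplaceDefect {κ : Measure ℝ} [IsProbabilityMeasure κ]
    (h0 : κ (Set.Iio 0) = 0) : ContinuousOn (laplaceDefect κ) (Set.Ici 0) := by
  refine continuousOn_const.sub ?_
  refine continuousOn_of_dominated (bound := fun _ => 1) (fun s _ => by fun_prop) ?_
    (integrable_const _) (Eventually.of_forall fun x => by fun_prop)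
  intro s hs
  filter_upwards [ae_nonneg_of_measure_Iio h0] with x hx
  rw [Real.norm_eq_abs, abs_of_pos (Real.exp_pos _), Real.exp_le_one_iff]
  have : 0 ≤ s * x := mul_nonneg hs hx
  linarith

lemma integrableOn_exp_neg_Ioi : IntegrableOn (fun y : ℝ => Real.exp (-y)) (Set.Ioi 0) := by
  simpa using exp_neg_integrableOn_Ioi 0 zero_lt_one

/-- Integration by parts: the defect of the Laplace transform in terms of the tail. -/
lemma laplaceDefect_eq_integral_tail {κ : Measure ℝ} [IsProbabilityMeasure κ]
    (h0 : κ (Set.Iio 0) = 0) {t : ℝ} (ht : 0 < t) :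
    laplaceDefect κ (1 / t) = ∫ y in Set.Ioi 0, Real.exp (-y) * κ.real (Set.Ioi (t * y)) := by
  have hs : 0 ≤ 1 / t := by positivity
  have hlc := lintegral_comp_eq_lintegral_meas_lt_mul κ (f := fun x => 1 / t * x)
    (g := fun y => Real.exp (-y))
    (by
      filter_upwards [ae_nonneg_of_measure_Iio h0] with x hx
      exact mul_nonneg hs hx)
    (by fun_prop) (fun t _ => Continuous.intervalIntegrable (by fun_prop) _ _)
    (Eventually.of_forall fun y => (Real.exp_pos _).le)
  have hprim : ∀ x : ℝ, ∫ y in (0 : ℝ)..x, Real.exp (-y) = 1 - Real.exp (-x) := by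
    intro x; simp
  simp_rw [hprim] at hlc
  have hset : ∀ y : ℝ, {a : ℝ | y < 1 / t * a} = Set.Ioi (t * y) := by
    intro y; ext a
    simp only [Set.mem_ofPred_eq, Set.mem_Ioi]
    rw [one_div, ← div_eq_inv_mul, lt_div_iff₀ ht, mul_comm]
  simp_rw [hset] at hlc
  have hmeas : Measurable fun y => κ.real (Set.Ioi (t * y)) := by
    have : Antitone fun y => κ.real (Set.Ioi (t * y)) := fun y z hyz =>
      measureReal_mono (Set.Ioi_subset_Ioi (mul_le_mul_of_nonneg_left hyz ht.le))
    exact this.measurable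
  have h1 : ENNReal.ofReal (laplaceDefect κ (1 / t)) =
      ∫⁻ x, ENNReal.ofReal (1 - Real.exp (-(1 / t * x))) ∂κ := by
    rw [← ofReal_integral_eq_lintegral_ofReal]
    · rw [integral_sub (integrable_const _) (integrable_exp_neg h0 hs)]
      simp [laplaceDefect, laplace]
    · exact (integrable_const _).sub (integrable_exp_neg h0 hs)
    · filter_upwards [ae_nonneg_of_measure_Iio h0] with x hx
      have := mul_nonneg hs hx
      simpa using this
  have h2 : ∫⁻ y in Set.Ioi 0, κ (Set.Ioi (t * y)) * ENNReal.ofReal (Real.exp (-y)) =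
      ENNReal.ofReal (∫ y in Set.Ioi 0, Real.exp (-y) * κ.real (Set.Ioi (t * y))) := by
    rw [ofReal_integral_eq_lintegral_ofReal]
    · refine lintegral_congr fun y => ?_
      rw [ENNReal.ofReal_mul (Real.exp_pos _).le, ofReal_measureReal, mul_comm]
    · refine Integrable.mono' (g := fun y => Real.exp (-y)) ?_ (by fun_prop) ?_
      · exact integrableOn_exp_neg_Ioi
      · refine Eventually.of_forall fun y => ?_
        rw [Real.norm_of_nonneg (by positivity)]
        exact mul_le_of_le_one_right (Real.exp_pos _).le measureReal_le_one
    · exact Eventually.of_forall fun y => by positivity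
  rw [h2, ← h1] at hlc
  refine (ENNReal.ofReal_eq_ofReal_iff (laplaceDefect_nonneg h0 hs) ?_).1 hlc
  exact integral_nonneg fun y => by positivity

/-- A Potter bound: a nonincreasing function of regular variation with index `-α` decays no
faster than `t ^ (-β)`, uniformly, for every `β > α`. -/
lemma RegularlyVarying.exists_potter_bound {f : ℝ → ℝ} {α β : ℝ} (hf : RegularlyVarying f (-α))
    (hanti : Antitone f) (h1 : ∀ x, f x ≤ 1) (hβ0 : 0 ≤ β) (hαβ : α < β) :
    ∃ C t₀ : ℝ, 0 < C ∧ 0 < t₀ ∧ ∀ t, t₀ ≤ t → ∀ s, 0 < s → s ≤ t →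
      s ^ β * f s ≤ C * (t ^ β * f t) := by
  have hlim := hf.tendsto (1 / 2) (by norm_num)
  have hlt : ((1 : ℝ) / 2) ^ (-α) < 2 ^ β := by
    rw [one_div, Real.inv_rpow (by norm_num), Real.rpow_neg (by norm_num), inv_inv]
    exact Real.rpow_lt_rpow_of_exponent_lt (by norm_num) hαβ
  obtain ⟨t₀, ht₀⟩ := eventually_atTop.1
    ((hlim.eventually_le_const hlt).and (eventually_gt_atTop (0 : ℝ)))
  have ht₀pos : 0 < t₀ := (ht₀ t₀ le_rfl).2
  have hhalf : ∀ t, t₀ ≤ t → (t / 2) ^ β * f (t / 2) ≤ t ^ β * f t := by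
    intro t ht
    have htpos : 0 < t := ht₀pos.trans_le ht
    have h := (ht₀ t ht).1
    rw [div_le_iff₀ (hf.pos t htpos), show 1 / 2 * t = t / 2 by ring] at h
    calc (t / 2) ^ β * f (t / 2) ≤ (t / 2) ^ β * (2 ^ β * f t) := by gcongr
      _ = t ^ β * f t := by
        rw [← mul_assoc, ← Real.mul_rpow (by positivity) (by norm_num)]
        congr 2; ring
  set C₁ := (2 * t₀) ^ β / (t₀ ^ β * f (2 * t₀)) with hC₁
  have hC₁pos : 0 < C₁ := by
    have := hf.pos (2 * t₀) (by positivity)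
    positivity
  set C := max C₁ (2 ^ β) with hC
  have hCpos : 0 < C := lt_max_of_lt_left hC₁pos
  have main : ∀ n : ℕ, ∀ t, t₀ ≤ t → t ≤ 2 ^ (n + 1) * t₀ → ∀ s, 0 < s → s ≤ t →
      s ^ β * f s ≤ C * (t ^ β * f t) := by
    intro n
    induction n with
    | zero =>
      intro t ht ht' s hs hst
      have htpos : 0 < t := ht₀pos.trans_le ht
      have hft := hf.pos (2 * t₀) (by positivity)
      have h2 : t ≤ 2 * t₀ := by simpa using ht'
      calc s ^ β * f s ≤ (2 * t₀) ^ β * 1 := by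
            have := (hf.pos s hs).le
            gcongr
            · exact hst.trans h2
            · exact h1 s
        _ = C₁ * (t₀ ^ β * f (2 * t₀)) := by
            rw [hC₁]; field_simp
        _ ≤ C * (t ^ β * f t) := by
            have h3 := hanti h2
            gcongr
            exact le_max_left _ _
    | succ n ih =>
      intro t ht ht' s hs hst
      have htpos : 0 < t := ht₀pos.trans_le ht
      rcases le_or_gt t (2 ^ (n + 1) * t₀) with h | h
      · exact ih t ht h s hs hst
      have ht2 : t₀ ≤ t / 2 := by
        have : (2 : ℝ) ≤ 2 ^ (n + 1) := by
          calc (2 : ℝ) = 2 ^ 1 := by norm_num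
            _ ≤ 2 ^ (n + 1) := pow_le_pow_right₀ (by norm_num) (by omega)
        nlinarith
      have ht2' : t / 2 ≤ 2 ^ (n + 1) * t₀ := by
        rw [pow_succ] at ht'; linarith
      rcases le_or_gt s (t / 2) with hs2 | hs2
      · exact (ih (t / 2) ht2 ht2' s hs hs2).trans
          (mul_le_mul_of_nonneg_left (hhalf t ht) hCpos.le)
      · have hp := (hf.pos (t / 2) (by positivity)).le
        calc s ^ β * f s ≤ t ^ β * f (t / 2) := by
              have := (hf.pos s hs).le
              gcongr
              exact hanti hs2.le
          _ = 2 ^ β * ((t / 2) ^ β * f (t / 2)) := by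
              rw [← mul_assoc, ← Real.mul_rpow (by norm_num) (by positivity)]
              congr 2; ring
          _ ≤ C * (t ^ β * f t) := by
              have := hhalf t ht
              gcongr
              exact le_max_right _ _
  refine ⟨C, t₀, hCpos, ht₀pos, fun t ht s hs hst => ?_⟩
  obtain ⟨n, hn⟩ := pow_unbounded_of_one_lt (t / t₀) (one_lt_two (α := ℝ))
  refine main n t ht ?_ s hs hst
  rw [div_lt_iff₀ ht₀pos] at hn
  refine hn.le.trans ?_
  gcongr
  · norm_num
  · omega

variable {κ : Measure ℝ} [IsProbabilityMeasure κ] {α : ℝ}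

lemma antitone_tail (κ : Measure ℝ) [IsProbabilityMeasure κ] :
    Antitone fun x => κ.real (Set.Ioi x) :=
  fun _ _ h => measureReal_mono (Set.Ioi_subset_Ioi h)

/-- The Abelian half of Karamata's Tauberian theorem. -/
theorem tendsto_laplaceDefect_div_tail (h0 : κ (Set.Iio 0) = 0) (hα0 : 0 < α) (hα1 : α < 1)
    (hκ : RegularlyVarying (fun x => κ.real (Set.Ioi x)) (-α)) :
    Tendsto (fun t => laplaceDefect κ (1 / t) / κ.real (Set.Ioi t)) atTop
      (𝓝 (Real.Gamma (1 - α))) := by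
  obtain ⟨β, hαβ, hβ1⟩ := exists_between hα1
  obtain ⟨C, t₀, hC, ht₀, hpot⟩ := hκ.exists_potter_bound (antitone_tail κ)
    (fun _ => measureReal_le_one) (hα0.trans hαβ).le hαβ
  rw [Real.Gamma_eq_integral (by linarith)]
  have hEq : (fun t => laplaceDefect κ (1 / t) / κ.real (Set.Ioi t)) =ᶠ[atTop] fun t =>
      ∫ y in Set.Ioi 0, Real.exp (-y) * (κ.real (Set.Ioi (t * y)) / κ.real (Set.Ioi t)) := by
    filter_upwards [eventually_gt_atTop 0] with t ht
    rw [laplaceDefect_eq_integral_tail h0 ht, ← integral_div]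
    simp_rw [mul_div_assoc]
  rw [tendsto_congr' hEq]
  refine tendsto_integral_filter_of_dominated_convergence
    (fun y => C * (Real.exp (-y) * y ^ ((1 - β) - 1)) + Real.exp (-y)) ?_ ?_ ?_ ?_
  · filter_upwards [eventually_gt_atTop 0] with t ht
    have : Measurable fun y => κ.real (Set.Ioi (t * y)) :=
      ((antitone_tail κ).comp_monotone
        (fun y z hyz => mul_le_mul_of_nonneg_left hyz ht.le : Monotone fun y => t * y)).measurable
    fun_prop
  · filter_upwards [eventually_ge_atTop t₀] with t ht
    have htpos : 0 < t := ht₀.trans_le ht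
    have hft := hκ.pos t htpos
    refine (ae_restrict_mem measurableSet_Ioi).mono fun y hy => ?_
    have hy' : 0 < y := hy
    rw [Real.norm_of_nonneg (by positivity)]
    rcases le_or_gt y 1 with h | h
    · have h1 := hpot t ht (t * y) (by positivity) (by nlinarith)
      rw [Real.mul_rpow htpos.le hy'.le] at h1
      have htb : 0 < t ^ β := by positivity
      have hyb : 0 < y ^ β := by positivity
      have h2 : κ.real (Set.Ioi (t * y)) / κ.real (Set.Ioi t) ≤ C * y ^ (1 - β - 1) := by
        rw [show 1 - β - 1 = -β by ring, Real.rpow_neg hy'.le, div_le_iff₀ hft,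
          ← div_eq_mul_inv, div_mul_eq_mul_div, le_div_iff₀ hyb]
        have h3 : t ^ β * (κ.real (Set.Ioi (t * y)) * y ^ β) ≤
            t ^ β * (C * κ.real (Set.Ioi t)) := by linarith
        exact le_of_mul_le_mul_left h3 htb
      calc Real.exp (-y) * (κ.real (Set.Ioi (t * y)) / κ.real (Set.Ioi t))
          ≤ Real.exp (-y) * (C * y ^ (1 - β - 1)) := by gcongr
        _ = C * (Real.exp (-y) * y ^ (1 - β - 1)) := by ring
        _ ≤ _ := le_add_of_nonneg_right (Real.exp_pos _).le
    · have h2 : κ.real (Set.Ioi (t * y)) / κ.real (Set.Ioi t) ≤ 1 := by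
        rw [div_le_one hft]
        exact antitone_tail κ (by nlinarith)
      calc Real.exp (-y) * (κ.real (Set.Ioi (t * y)) / κ.real (Set.Ioi t))
          ≤ Real.exp (-y) * 1 := by gcongr
        _ = Real.exp (-y) := mul_one _
        _ ≤ _ := le_add_of_nonneg_left (by positivity)
  · refine Integrable.add ?_ ?_
    · exact (Real.GammaIntegral_convergent (by linarith : 0 < 1 - β)).const_mul C
    · exact integrableOn_exp_neg_Ioi
  · refine (ae_restrict_mem measurableSet_Ioi).mono fun y hy => ?_
    refine Tendsto.const_mul _ ?_
    rw [show 1 - α - 1 = -α by ring]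
    simpa only [mul_comm y] using hκ.tendsto y hy

/-- The defect of the Laplace transform is regularly varying at `0` with index `α`. -/
theorem tendsto_laplaceDefect_mul_div (h0 : κ (Set.Iio 0) = 0) (hα0 : 0 < α) (hα1 : α < 1)
    (hκ : RegularlyVarying (fun x => κ.real (Set.Ioi x)) (-α)) {c : ℝ} (hc : 0 < c) :
    Tendsto (fun s => laplaceDefect κ (c * s) / laplaceDefect κ s) (𝓝[>] 0) (𝓝 (c ^ α)) := by
  have hΓ : 0 < Real.Gamma (1 - α) := Real.Gamma_pos_of_pos (by linarith)
  have h1 := tendsto_laplaceDefect_div_tail h0 hα0 hα1 hκ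
  have hcomp : Tendsto (fun t : ℝ => c⁻¹ * t) atTop atTop :=
    tendsto_id.const_mul_atTop (by positivity)
  have h2 := ((h1.comp hcomp).mul (hκ.tendsto c⁻¹ (by positivity))).div h1 hΓ.ne'
  have hval : Real.Gamma (1 - α) * c⁻¹ ^ (-α) / Real.Gamma (1 - α) = c ^ α := by
    rw [Real.inv_rpow hc.le, Real.rpow_neg hc.le, inv_inv]; field_simp
  rw [hval] at h2
  have h3 : Tendsto (fun t => laplaceDefect κ (c * t⁻¹) / laplaceDefect κ t⁻¹) atTop
      (𝓝 (c ^ α)) := by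
    refine h2.congr' ?_
    filter_upwards [eventually_gt_atTop 0] with t ht
    have := (hκ.pos t ht).ne'
    have := (hκ.pos (c⁻¹ * t) (by positivity)).ne'
    have he : 1 / (c⁻¹ * t) = c * t⁻¹ := by field_simp
    change laplaceDefect κ (1 / (c⁻¹ * t)) / κ.real (Set.Ioi (c⁻¹ * t)) *
      (κ.real (Set.Ioi (c⁻¹ * t)) / κ.real (Set.Ioi t)) /
      (laplaceDefect κ (1 / t) / κ.real (Set.Ioi t)) = _
    rw [he, one_div, div_mul_div_cancel₀ ‹_›, div_div_div_cancel_right₀ ‹_›]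
  have := h3.comp tendsto_inv_nhdsGT_zero
  simpa [Function.comp_def] using this

/-- A generalized inverse of the defect of the Laplace transform, with values in `(0,1]`. -/
lemma exists_laplaceDefect_inverse (h0 : κ (Set.Iio 0) = 0) (hpos : 0 < κ.real (Set.Ioi 0)) :
    ∃ σ : ℝ → ℝ, ∀ y, 0 < y → 0 < σ y ∧ σ y ≤ 1 ∧
      laplaceDefect κ (σ y) = min y (laplaceDefect κ 1) := by
  have hmono := strictMonoOn_laplaceDefect h0 hpos
  have h1 : 0 < laplaceDefect κ 1 := by
    have := hmono (Set.mem_Ici.2 le_rfl) (Set.mem_Ici.2 zero_le_one) zero_lt_one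
    rwa [laplaceDefect_zero] at this
  have : ∀ y, 0 < y → ∃ s, 0 < s ∧ s ≤ 1 ∧ laplaceDefect κ s = min y (laplaceDefect κ 1) := by
    intro y hy
    have hmem : min y (laplaceDefect κ 1) ∈
        Set.Icc (laplaceDefect κ 0) (laplaceDefect κ 1) := by
      rw [laplaceDefect_zero]
      exact ⟨(lt_min hy h1).le, min_le_right _ _⟩
    obtain ⟨s, hs, hseq⟩ := intermediate_value_Icc zero_le_one
      ((continuousOn_laplaceDefect h0).mono Set.Icc_subset_Ici_self) hmem
    refine ⟨s, lt_of_le_of_ne hs.1 ?_, hs.2, hseq⟩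
    rintro rfl
    rw [laplaceDefect_zero] at hseq
    exact (lt_min hy h1).ne hseq
  choose! σ hσ using this
  exact ⟨σ, hσ⟩

/-- Norming functions exist: the inverse `σ` of the defect `ψ` of the Laplace transform gives
`b x = 1 / σ (1 / x)`, which inverts the regular variation of `ψ` at `0`. -/
theorem exists_regularlyVarying_norming (h0 : κ (Set.Iio 0) = 0) (hα0 : 0 < α) (hα1 : α < 1)
    (hκ : RegularlyVarying (fun x => κ.real (Set.Ioi x)) (-α)) :
    ∃ b : ℝ → ℝ, RegularlyVarying b (1 / α) ∧ ∀ s, 0 < s →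
      Tendsto (fun n : ℕ => (n : ℝ) * laplaceDefect κ (s / b n)) atTop (𝓝 (s ^ α)) := by
  have hpos : 0 < κ.real (Set.Ioi 0) :=
    (hκ.pos 1 one_pos).trans_le (antitone_tail κ zero_le_one)
  have hmono := strictMonoOn_laplaceDefect h0 hpos
  have hψpos : ∀ s, 0 < s → 0 < laplaceDefect κ s := by
    intro s hs
    have := hmono (Set.mem_Ici.2 le_rfl) (Set.mem_Ici.2 hs.le) hs
    rwa [laplaceDefect_zero] at this
  obtain ⟨σ, hσ⟩ := exists_laplaceDefect_inverse h0 hpos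
  have hσmono : ∀ y z, 0 < y → y ≤ z → σ y ≤ σ z := by
    intro y z hy hyz
    have hz := hy.trans_le hyz
    refine (hmono.le_iff_le (hσ y hy).1.le (hσ z hz).1.le).1 ?_
    rw [(hσ y hy).2.2, (hσ z hz).2.2]
    exact min_le_min_right _ hyz
  have hσ0 : Tendsto σ (𝓝[>] 0) (𝓝[>] 0) := by
    refine tendsto_nhdsWithin_iff.2 ⟨?_, eventually_nhdsWithin_of_forall fun y hy => (hσ y hy).1⟩
    refine tendsto_order.2 ⟨fun a ha => ?_, fun a ha => ?_⟩
    · filter_upwards [self_mem_nhdsWithin] with y hy using ha.trans (hσ y hy).1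
    · filter_upwards [Ioo_mem_nhdsGT (hψpos a ha)] with y hy
      refine (hmono.lt_iff_lt (hσ y hy.1).1.le ha.le).1 ?_
      rw [(hσ y hy.1).2.2]
      exact (min_le_left _ _).trans_lt hy.2
  have hψσ : ∀ᶠ y in 𝓝[>] (0 : ℝ), 0 < y ∧ laplaceDefect κ (σ y) = y := by
    filter_upwards [Ioo_mem_nhdsGT (hψpos 1 one_pos)] with y hy
    refine ⟨hy.1, ?_⟩
    rw [(hσ y hy.1).2.2, min_eq_left hy.2.le]
  have hscale : ∀ c : ℝ, 0 < c → Tendsto (fun y => c * y) (𝓝[>] 0) (𝓝[>] 0) := by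
    intro c hc
    refine tendsto_nhdsWithin_iff.2 ⟨?_, eventually_nhdsWithin_of_forall fun y hy =>
      mul_pos hc hy⟩
    have : Tendsto (fun y => c * y) (𝓝 0) (𝓝 (c * 0)) := tendsto_id.const_mul c
    rw [mul_zero] at this
    exact this.mono_left nhdsWithin_le_nhds
  -- the inverse function is regularly varying at `0` with the inverse index
  have hσrv : ∀ c : ℝ, 0 < c → Tendsto (fun y => σ (c * y) / σ y) (𝓝[>] 0)
      (𝓝 (c ^ (1 / α))) := by
    intro c hc
    have hcα : (c ^ (1 / α)) ^ α = c := by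
      rw [← Real.rpow_mul hc.le, one_div_mul_cancel hα0.ne', Real.rpow_one]
    have hcpos : 0 < c ^ (1 / α) := by positivity
    refine tendsto_order.2 ⟨fun a ha => ?_, fun a ha => ?_⟩
    · rcases le_or_gt a 0 with ha0 | ha0
      · filter_upwards [self_mem_nhdsWithin] with y hy
        have hy' : 0 < y := hy
        exact ha0.trans_lt (div_pos (hσ _ (mul_pos hc hy')).1 (hσ y hy').1)
      have hlt : a ^ α < c := by
        rw [← hcα]; exact Real.rpow_lt_rpow ha0.le ha hα0
      have := ((tendsto_laplaceDefect_mul_div h0 hα0 hα1 hκ ha0).comp hσ0).eventually_lt_const hlt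
      filter_upwards [this, hψσ, (hscale c hc).eventually hψσ] with y hy1 hy2 hy3
      simp only [Function.comp] at hy1
      rw [hy2.2, div_lt_iff₀ hy2.1, ← hy3.2] at hy1
      rw [lt_div_iff₀ (hσ y hy2.1).1]
      exact (hmono.lt_iff_lt (mul_nonneg ha0.le (hσ y hy2.1).1.le) (hσ _ hy3.1).1.le).1 hy1
    · have ha0 : 0 < a := hcpos.trans ha
      have hlt : c < a ^ α := by
        conv_lhs => rw [← hcα]
        exact Real.rpow_lt_rpow hcpos.le ha hα0
      have := ((tendsto_laplaceDefect_mul_div h0 hα0 hα1 hκ ha0).comp hσ0).eventually_const_lt hlt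
      filter_upwards [this, hψσ, (hscale c hc).eventually hψσ] with y hy1 hy2 hy3
      simp only [Function.comp] at hy1
      rw [hy2.2, lt_div_iff₀ hy2.1, ← hy3.2] at hy1
      rw [div_lt_iff₀ (hσ y hy2.1).1]
      exact (hmono.lt_iff_lt (hσ _ hy3.1).1.le (mul_nonneg ha0.le (hσ y hy2.1).1.le)).1 hy1
  have hinv : Tendsto (fun x : ℝ => 1 / x) atTop (𝓝[>] 0) := by
    simpa using tendsto_inv_atTop_nhdsGT_zero (𝕜 := ℝ)
  refine ⟨fun x => 1 / σ (1 / x), ⟨?_, ?_, ?_⟩, ?_⟩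
  · have : Monotone fun x : Set.Ioi (0 : ℝ) => 1 / σ (1 / (x : ℝ)) := by
      intro x y hxy
      have hx : 0 < (x : ℝ) := x.2
      have hxy' : (x : ℝ) ≤ y := hxy
      have hy : 0 < (y : ℝ) := y.2
      exact one_div_le_one_div_of_le (hσ _ (by positivity)).1
        (hσmono _ _ (by positivity) (one_div_le_one_div_of_le hx hxy'))
    exact this.measurable
  · intro x hx
    exact one_div_pos.2 (hσ _ (by positivity)).1
  · intro c hc
    have h1 := ((hσrv c⁻¹ (by positivity)).comp hinv).inv₀ (by positivity)
    rw [Real.inv_rpow hc.le, inv_inv] at h1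
    refine h1.congr fun x => ?_
    simp only [Function.comp, one_div, inv_div, mul_inv]
    rw [inv_div_inv]
  · intro s hs
    have h1 := ((tendsto_laplaceDefect_mul_div h0 hα0 hα1 hκ hs).comp hσ0).comp
      (hinv.comp tendsto_natCast_atTop_atTop)
    refine h1.congr' ?_
    filter_upwards [(hinv.comp tendsto_natCast_atTop_atTop).eventually hψσ] with n hn
    simp only [Function.comp] at hn ⊢
    rw [hn.2]
    simp only [one_div, div_inv_eq_mul]
    rw [mul_comm]

end

/-! ### Uniform convergence for regularly varying functions -/

section

/-- The uniform convergence theorem in additive form. Measurability of `f` enters through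
convergence in measure: if `u n ∈ [0,1]` were exceptional shifts at `x n`, then most `v ∈ [u n, 2]`
would make both `f (x n + v) - f (x n)` and `f (x n + v) - f (x n + u n)` small. -/
theorem eventually_forall_abs_sub_lt {f : ℝ → ℝ} (hf : Measurable f)
    (h : ∀ u, Tendsto (fun x => f (x + u) - f x) atTop (𝓝 0)) {ε : ℝ} (hε : 0 < ε) :
    ∀ᶠ x in atTop, ∀ u ∈ Set.Icc (0 : ℝ) 1, |f (x + u) - f x| < ε := by
  by_contra hcon
  rw [not_eventually] at hcon
  obtain ⟨x, hx, hbad⟩ := exists_seq_forall_of_frequently hcon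
  push Not at hbad
  choose u hu hubad using hbad
  have key : ∀ y : ℕ → ℝ, Tendsto y atTop atTop → Tendsto (fun n =>
      volume.restrict (Set.Icc (0 : ℝ) 2) {v | ε / 2 ≤ ‖(f (y n + v) - f (y n)) - 0‖}) atTop
        (𝓝 0) := by
    intro y hy
    have : TendstoInMeasure (volume.restrict (Set.Icc (0 : ℝ) 2))
        (fun n v => f (y n + v) - f (y n)) atTop (fun _ => 0) :=
      tendstoInMeasure_of_tendsto_ae
        (fun n => Measurable.aestronglyMeasurable (by fun_prop))
        (Eventually.of_forall fun v => (h v).comp hy)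
    exact tendstoInMeasure_iff_norm.1 this (ε / 2) (by positivity)
  have hy : Tendsto (fun n => x n + u n) atTop atTop :=
    tendsto_atTop_mono (fun n => le_add_of_nonneg_right (hu n).1) hx
  obtain ⟨n, hA, hB⟩ := (((key x hx).eventually_lt_const
    (show (0 : ENNReal) < ENNReal.ofReal (1 / 4) by simp)).and
    ((key _ hy).eventually_lt_const (show (0 : ENNReal) < ENNReal.ofReal (1 / 4) by simp))).exists
  rw [Measure.restrict_apply (measurableSet_le (by fun_prop) (by fun_prop))] at hA hB
  set A := {v | ε / 2 ≤ ‖(f (x n + v) - f (x n)) - 0‖} ∩ Set.Icc (0 : ℝ) 2 with hAdef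
  set B := {v | ε / 2 ≤ ‖(f (x n + u n + v) - f (x n + u n)) - 0‖} ∩ Set.Icc (0 : ℝ) 2 with hBdef
  have hsub : Set.Icc (u n) 2 ⊆ A ∪ (fun v => v + -u n) ⁻¹' B := by
    intro v hv
    by_contra hvn
    simp only [Set.mem_union, not_or] at hvn
    have h1 : ‖(f (x n + v) - f (x n)) - 0‖ < ε / 2 := by
      by_contra hc
      exact hvn.1 ⟨not_lt.1 hc, (hu n).1.trans hv.1, hv.2⟩
    have h2 : ‖(f (x n + u n + (v + -u n)) - f (x n + u n)) - 0‖ < ε / 2 := by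
      by_contra hc
      refine hvn.2 ⟨not_lt.1 hc, ?_, ?_⟩
      · have := hv.1; change 0 ≤ v + -u n; linarith
      · have := hv.2; have := (hu n).1; change v + -u n ≤ 2; linarith
    rw [show x n + u n + (v + -u n) = x n + v by ring] at h2
    rw [sub_zero, Real.norm_eq_abs, abs_lt] at h1 h2
    have h3 := hubad n
    rw [le_abs] at h3
    rcases h3 with h3 | h3 <;> linarith [h1.1, h1.2, h2.1, h2.2]
  have hvol := (measure_mono hsub).trans (measure_union_le (μ := volume) _ _)
  rw [measure_preimage_add_right, Real.volume_Icc] at hvol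
  have h4 := hvol.trans_lt (ENNReal.add_lt_add hA hB)
  rw [← ENNReal.ofReal_add (by norm_num) (by norm_num),
    ENNReal.ofReal_lt_ofReal_iff (by norm_num)] at h4
  have := (hu n).2
  linarith

/-- A regularly varying function does not feel the rounding of its argument. This fails without
measurability. -/
theorem RegularlyVarying.tendsto_div_natFloor {b : ℝ → ℝ} {ρ : ℝ} (hb : RegularlyVarying b ρ) :
    Tendsto (fun x => b x / b (⌊x⌋₊ : ℝ)) atTop (𝓝 1) := by
  set f : ℝ → ℝ := fun y => Real.log (b (Real.exp y)) - ρ * y with hf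
  have hmeas : Measurable f := by
    have : Measurable fun y : ℝ => b (Real.exp y) :=
      hb.measurable.comp
        (Real.measurable_exp.subtype_mk (h := fun y => Set.mem_Ioi.2 (Real.exp_pos y)))
    exact this.log.sub (by fun_prop)
  have hbe : ∀ y, 0 < b (Real.exp y) := fun y => hb.pos _ (Real.exp_pos y)
  have hlim : ∀ u, Tendsto (fun x => f (x + u) - f x) atTop (𝓝 0) := by
    intro u
    have h1 := (hb.tendsto (Real.exp u) (Real.exp_pos u)).comp Real.tendsto_exp_atTop
    have h2 := (h1.log (by positivity)).sub_const (ρ * u)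
    rw [← Real.exp_mul, Real.log_exp, mul_comm u ρ, sub_self] at h2
    refine h2.congr fun x => ?_
    simp only [Function.comp, hf]
    rw [← Real.exp_add, add_comm u x, Real.log_div (hbe _).ne' (hbe _).ne']
    ring
  have hfl : Tendsto (fun x : ℝ => Real.log x - Real.log (⌊x⌋₊ : ℝ)) atTop (𝓝 0) := by
    have h1 := ((tendsto_nat_floor_div_atTop (R := ℝ)).inv₀ one_ne_zero).log (by norm_num)
    rw [inv_one, Real.log_one] at h1
    refine h1.congr' ?_
    filter_upwards [eventually_ge_atTop 1] with x hx
    have : 0 < (⌊x⌋₊ : ℝ) := by exact_mod_cast Nat.floor_pos.2 hx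
    rw [inv_div, Real.log_div (by positivity) this.ne']
  have hlogfl : Tendsto (fun x : ℝ => Real.log (⌊x⌋₊ : ℝ)) atTop atTop :=
    Real.tendsto_log_atTop.comp (tendsto_natCast_atTop_atTop.comp tendsto_nat_floor_atTop)
  have hmain : Tendsto (fun x : ℝ => f (Real.log x) - f (Real.log (⌊x⌋₊ : ℝ))) atTop (𝓝 0) := by
    rw [Metric.tendsto_nhds]
    intro ε hε
    filter_upwards [hlogfl.eventually (eventually_forall_abs_sub_lt hmeas hlim hε),
      hfl.eventually_le_const zero_lt_one, eventually_ge_atTop 1] with x h1 h2 hx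
    have hfx : 0 < (⌊x⌋₊ : ℝ) := by exact_mod_cast Nat.floor_pos.2 hx
    have h3 := h1 (Real.log x - Real.log (⌊x⌋₊ : ℝ))
      ⟨sub_nonneg.2 (Real.log_le_log hfx (Nat.floor_le (by linarith))), h2⟩
    rw [add_sub_cancel] at h3
    rwa [Real.dist_eq, sub_zero]
  have h5 := (hmain.add (hfl.const_mul ρ)).rexp
  simp only [mul_zero, add_zero, Real.exp_zero] at h5
  refine h5.congr' ?_
  filter_upwards [eventually_ge_atTop 1] with x hx
  have hx0 : 0 < x := by linarith
  have hfx : 0 < (⌊x⌋₊ : ℝ) := by exact_mod_cast Nat.floor_pos.2 hx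
  simp only [hf]
  rw [Real.exp_log hx0, Real.exp_log hfx]
  rw [show Real.log (b x) - ρ * Real.log x - (Real.log (b ⌊x⌋₊) - ρ * Real.log ⌊x⌋₊) +
    ρ * (Real.log x - Real.log ⌊x⌋₊) = Real.log (b x) - Real.log (b ⌊x⌋₊) by ring,
    Real.exp_sub, Real.exp_log (hb.pos _ hx0), Real.exp_log (hb.pos _ hfx)]

/-- The asymptotics of the defect of the Laplace transform along the norming constants, passed from
integers to all real arguments. -/
theorem RegularlyVarying.tendsto_mul_laplaceDefect {κ : Measure ℝ} [IsProbabilityMeasure κ]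
    (h0 : κ (Set.Iio 0) = 0) (hpos : 0 < κ.real (Set.Ioi 0)) {α ρ : ℝ}
    {b : ℝ → ℝ} (hb : RegularlyVarying b ρ)
    (hlim : ∀ s, 0 < s →
      Tendsto (fun n : ℕ => (n : ℝ) * laplaceDefect κ (s / b n)) atTop (𝓝 (s ^ α)))
    {s : ℝ} (hs : 0 < s) :
    Tendsto (fun x => x * laplaceDefect κ (s / b x)) atTop (𝓝 (s ^ α)) := by
  have hmono := (strictMonoOn_laplaceDefect h0 hpos).monotoneOn
  have hcont : Tendsto (fun r : ℝ => r ^ α) (𝓝 s) (𝓝 (s ^ α)) :=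
    Real.continuousAt_rpow_const s α (Or.inl hs.ne')
  have hfloor := tendsto_nat_floor_atTop (α := ℝ)
  have hquot := hb.tendsto_div_natFloor
  refine tendsto_order.2 ⟨fun a ha => ?_, fun a ha => ?_⟩
  · obtain ⟨r, har, hr0, hrs⟩ : ∃ r, a < r ^ α ∧ 0 < r ∧ r < s :=
      (((hcont.mono_left nhdsWithin_le_nhds).eventually_const_lt ha).and
        (Ioo_mem_nhdsLT hs)).exists
    have h1 := ((hlim r hr0).comp hfloor).eventually_const_lt har
    have h2 := hquot.eventually_lt_const (show 1 < s / r by rwa [one_lt_div hr0])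
    filter_upwards [h1, h2, eventually_ge_atTop 1] with x h1 h2 hx
    have hx0 : 0 < x := by linarith
    have hfx : 0 < (⌊x⌋₊ : ℝ) := by exact_mod_cast Nat.floor_pos.2 hx
    have hb1 := hb.pos _ hx0
    have hb2 := hb.pos _ hfx
    have h3 : r / b ⌊x⌋₊ ≤ s / b x := by
      rw [div_lt_div_iff₀ hb2 hr0] at h2
      rw [div_le_div_iff₀ hb2 hb1]
      linarith
    have h4 := hmono (Set.mem_Ici.2 (by positivity)) (Set.mem_Ici.2 (by positivity)) h3
    refine h1.trans_le ?_
    exact mul_le_mul (Nat.floor_le hx0.le) h4 (laplaceDefect_nonneg h0 (by positivity)) hx0.le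
  · obtain ⟨r, har, hrs⟩ : ∃ r, r ^ α < a ∧ s < r :=
      (((hcont.mono_left nhdsWithin_le_nhds).eventually_lt_const ha).and
        (self_mem_nhdsWithin (s := Set.Ioi s))).exists
    have hr0 : 0 < r := hs.trans hrs
    have hinv := (tendsto_nat_floor_div_atTop (R := ℝ)).inv₀ one_ne_zero
    have h1 := (hinv.mul ((hlim r hr0).comp hfloor)).eventually_lt_const
      (show (1 : ℝ)⁻¹ * r ^ α < a by simpa using har)
    have h2 := hquot.eventually_const_lt (show s / r < 1 by rwa [div_lt_one hr0])
    filter_upwards [h1, h2, eventually_ge_atTop 1] with x h1 h2 hx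
    have hx0 : 0 < x := by linarith
    have hfx : 0 < (⌊x⌋₊ : ℝ) := by exact_mod_cast Nat.floor_pos.2 hx
    have hb1 := hb.pos _ hx0
    have hb2 := hb.pos _ hfx
    have h3 : s / b x ≤ r / b ⌊x⌋₊ := by
      rw [div_lt_div_iff₀ hr0 hb2] at h2
      rw [div_le_div_iff₀ hb1 hb2]
      linarith
    have h4 := hmono (Set.mem_Ici.2 (by positivity)) (Set.mem_Ici.2 (by positivity)) h3
    refine lt_of_le_of_lt (mul_le_mul_of_nonneg_left h4 hx0.le) ?_
    simp only [Function.comp] at h1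
    rwa [inv_div, ← mul_assoc, div_mul_cancel₀ _ hfx.ne'] at h1

end

/-! ### Limits of normalized maxima of independent variables -/

section

lemma exists_cdf_mem_Ioo (G : Measure ℝ) [IsProbabilityMeasure G]
    (hG : ∀ c : ℝ, G ≠ Measure.dirac c) : ∃ x, 0 < cdf G x ∧ cdf G x < 1 := by
  by_contra hcon
  push Not at hcon
  have h01 : ∀ x, cdf G x = 0 ∨ cdf G x = 1 := by
    intro x
    rcases (cdf_nonneg G x).eq_or_lt with h | h
    · exact Or.inl h.symm
    · exact Or.inr (le_antisymm (cdf_le_one G x) (hcon x h))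
  set S := {x | cdf G x = 1} with hS
  have hne : S.Nonempty := by
    obtain ⟨x, hx⟩ := ((tendsto_cdf_atTop G).eventually_const_lt zero_lt_one).exists
    exact ⟨x, (h01 x).resolve_left hx.ne'⟩
  have hbdd : BddBelow S := by
    obtain ⟨y, hy⟩ := ((tendsto_cdf_atBot G).eventually_lt_const zero_lt_one).exists
    refine ⟨y, fun x hx => ?_⟩
    by_contra hlt
    have h1 := monotone_cdf G (not_le.1 hlt).le
    rw [show cdf G x = 1 from hx] at h1
    linarith
  refine hG (sInf S) (Measure.eq_of_cdf _ _ ?_)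
  have hgt : ∀ x, sInf S < x → cdf G x = 1 := by
    intro x hx
    obtain ⟨s, hs, hsx⟩ := exists_lt_of_csInf_lt hne hx
    refine le_antisymm (cdf_le_one G x) ?_
    rw [← show cdf G s = 1 from hs]
    exact monotone_cdf G hsx.le
  ext x
  have hdirac : cdf (Measure.dirac (sInf S)) x = if sInf S ≤ x then 1 else 0 := by
    rw [cdf_eq_real, measureReal_def, Measure.dirac_apply' _ measurableSet_Iic]
    by_cases h : sInf S ≤ x <;> simp [h]
  rw [hdirac]
  split_ifs with h
  · have hr : Tendsto (cdf G) (𝓝[>] x) (𝓝 (cdf G x)) :=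
      ((cdf G).right_continuous x).mono_left (nhdsWithin_mono _ Set.Ioi_subset_Ici_self)
    refine tendsto_nhds_unique hr ?_
    refine (tendsto_const_nhds (x := (1 : ℝ))).congr' ?_
    filter_upwards [self_mem_nhdsWithin] with y hy
    exact (hgt y (h.trans_lt hy)).symm
  · refine (h01 x).resolve_right fun h1 => h (csInf_le hbdd h1)

/-- A form of Khinchin's convergence of types theorem: if monotone functions `H n` converge to a
non-degenerate distribution function `g`, and `(H n) ^ k` rescaled by increasing affine maps
converges to `g` as well, then `g` satisfies the max-stability relation `g (A x + B) ^ k = g x`.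
The affine maps stay in a compact set, so that a subsequence of them converges. -/
theorem exists_affine_of_tendsto {G : Measure ℝ} [IsProbabilityMeasure G]
    (hG : ∀ c : ℝ, G ≠ Measure.dirac c) {H : ℕ → ℝ → ℝ} (hmono : ∀ n, Monotone (H n))
    (hnn : ∀ n x, 0 ≤ H n x) {a d : ℕ → ℝ} (ha : ∀ n, 0 < a n) {k : ℕ} (hk : k ≠ 0)
    (h1 : ∀ x, Tendsto (fun n => H n x) atTop (𝓝 (cdf G x)))
    (h2 : ∀ x, Tendsto (fun n => H n (a n * x + d n) ^ k) atTop (𝓝 (cdf G x))) :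
    ∃ A B : ℝ, 0 < A ∧ ∀ x, cdf G (A * x + B) ^ k = cdf G x := by
  set g := cdf G with hg
  have gmono : Monotone g := monotone_cdf G
  have gnn : ∀ x, 0 ≤ g x := cdf_nonneg G
  have gle : ∀ x, g x ≤ 1 := cdf_le_one G
  have gright : ∀ x, Tendsto g (𝓝[>] x) (𝓝 (g x)) := fun x =>
    (g.right_continuous x).mono_left (nhdsWithin_mono _ Set.Ioi_subset_Ici_self)
  obtain ⟨y₁, hy₁0, hy₁1⟩ := exists_cdf_mem_Ioo G hG
  obtain ⟨y₂, hy₂1, hy₁₂⟩ : ∃ y₂, g y₂ < 1 ∧ y₁ < y₂ :=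
    (((gright y₁).eventually_lt_const hy₁1).and self_mem_nhdsWithin).exists
  have hy₂0 : 0 < g y₂ := hy₁0.trans_le (gmono hy₁₂.le)
  have hbound : ∀ y, 0 < g y → g y < 1 →
      ∃ L U, ∀ᶠ n in atTop, a n * y + d n ∈ Set.Icc L U := by
    intro y hy0 hy1
    have hU := ((tendsto_cdf_atTop G).pow k).eventually_const_lt (show g y < 1 ^ k by simpa)
    have hL := ((tendsto_cdf_atBot G).pow k).eventually_lt_const
      (show (0 : ℝ) ^ k < g y by simpa [hk])
    obtain ⟨U, hU⟩ := hU.exists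
    obtain ⟨L, hL⟩ := hL.exists
    refine ⟨L, U, ?_⟩
    filter_upwards [(h2 y).eventually_lt ((h1 U).pow k) hU,
      ((h1 L).pow k).eventually_lt (h2 y) hL] with n hn1 hn2
    exact ⟨((hmono n).reflect_lt (lt_of_pow_lt_pow_left₀ k (hnn n _) hn2)).le,
      ((hmono n).reflect_lt (lt_of_pow_lt_pow_left₀ k (hnn n _) hn1)).le⟩
  obtain ⟨L₁, U₁, hb₁⟩ := hbound y₁ hy₁0 hy₁1
  obtain ⟨L₂, U₂, hb₂⟩ := hbound y₂ hy₂0 hy₂1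
  obtain ⟨⟨v₁, v₂⟩, -, φ, hφ, hlim⟩ :=
    ((isCompact_Icc (a := L₁) (b := U₁)).prod (isCompact_Icc (a := L₂) (b := U₂))).tendsto_subseq'
      (x := fun n => (a n * y₁ + d n, a n * y₂ + d n))
      ((hb₁.and hb₂).frequently.mono fun n hn => Set.mk_mem_prod hn.1 hn.2)
  have hv₁ : Tendsto (fun n => a (φ n) * y₁ + d (φ n)) atTop (𝓝 v₁) :=
    (continuous_fst.tendsto _).comp hlim
  have hv₂ : Tendsto (fun n => a (φ n) * y₂ + d (φ n)) atTop (𝓝 v₂) :=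
    (continuous_snd.tendsto _).comp hlim
  have hy : y₂ - y₁ ≠ 0 := (sub_pos.2 hy₁₂).ne'
  have hA : Tendsto (fun n => a (φ n)) atTop (𝓝 ((v₂ - v₁) / (y₂ - y₁))) := by
    refine ((hv₂.sub hv₁).div_const (y₂ - y₁)).congr fun n => ?_
    field_simp; ring
  set A := (v₂ - v₁) / (y₂ - y₁)
  have hB : Tendsto (fun n => d (φ n)) atTop (𝓝 (v₁ - A * y₁)) := by
    refine (hv₁.sub (hA.mul_const y₁)).congr fun n => ?_
    ring
  set B := v₁ - A * y₁
  have hA0 : 0 ≤ A := ge_of_tendsto' hA fun n => (ha _).le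
  have hAB : ∀ x, Tendsto (fun n => a (φ n) * x + d (φ n)) atTop (𝓝 (A * x + B)) := fun x =>
    (hA.mul_const x).add hB
  have hupper : ∀ x z, A * x + B < z → g x ≤ g z ^ k := by
    intro x z hz
    refine le_of_tendsto_of_tendsto ((h2 x).comp hφ.tendsto_atTop)
      (((h1 z).comp hφ.tendsto_atTop).pow k) ?_
    filter_upwards [(hAB x).eventually_lt_const hz] with n hn
    exact pow_le_pow_left₀ (hnn _ _) (hmono _ hn.le) k
  have hlower : ∀ x z, z < A * x + B → g z ^ k ≤ g x := by
    intro x z hz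
    refine le_of_tendsto_of_tendsto (((h1 z).comp hφ.tendsto_atTop).pow k)
      ((h2 x).comp hφ.tendsto_atTop) ?_
    filter_upwards [(hAB x).eventually_const_lt hz] with n hn
    exact pow_le_pow_left₀ (hnn _ _) (hmono _ hn.le) k
  have hApos : 0 < A := by
    refine lt_of_le_of_ne hA0 fun hA0 => ?_
    -- a limit scale `A = 0` would concentrate `G` at `B`
    have hlt : ∀ z, z < B → g z = 0 := by
      intro z hz
      have : g z ^ k ≤ 0 := ge_of_tendsto' (tendsto_cdf_atBot G) fun x =>
        hlower x z (by simpa [← hA0] using hz)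
      exact pow_eq_zero_iff hk |>.1 (le_antisymm this (pow_nonneg (gnn z) k))
    have hgt : ∀ z, B < z → g z = 1 := by
      intro z hz
      have : 1 ≤ g z ^ k := le_of_tendsto' (tendsto_cdf_atTop G) fun x =>
        hupper x z (by simpa [← hA0] using hz)
      by_contra hne
      exact absurd this (not_le.2 (pow_lt_one₀ (gnn z) (lt_of_le_of_ne (gle z) hne) hk))
    rcases lt_or_ge y₁ B with h | h
    · exact hy₁0.ne' (hlt _ h)
    · exact hy₂1.ne (hgt _ (h.trans_lt hy₁₂))
  refine ⟨A, B, hApos, fun x => le_antisymm ?_ ?_⟩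
  · refine ge_of_tendsto (gright x) ?_
    filter_upwards [self_mem_nhdsWithin] with z hz
    have hz' : x < z := hz
    exact hlower z _ (by nlinarith)
  · refine ge_of_tendsto ((gright (A * x + B)).pow k) ?_
    filter_upwards [self_mem_nhdsWithin] with z hz
    exact hupper x z hz

/-- A non-degenerate limit law of normalized maxima has no large gaps in the range of its
distribution function: by max-stability the range is closed under powers and roots. -/
theorem exists_cdf_mem_Ioo_of_tendsto_pow {F : ℝ → ℝ} (hF : Monotone F) (hF0 : ∀ x, 0 ≤ F x)
    {a d : ℕ → ℝ} (ha : ∀ n, 0 < a n) {G : Measure ℝ} [IsProbabilityMeasure G]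
    (hG : ∀ c : ℝ, G ≠ Measure.dirac c)
    (h : ∀ x, Tendsto (fun n => F (a n * x + d n) ^ n) atTop (𝓝 (cdf G x)))
    {p q : ℝ} (hp : 0 < p) (hpq : p < q) (hq : q ≤ 1) : ∃ x, p < cdf G x ∧ cdf G x < q := by
  have hstab : ∀ k : ℕ, k ≠ 0 → ∃ A B : ℝ, 0 < A ∧ ∀ x, cdf G (A * x + B) ^ k = cdf G x := by
    intro k hk
    refine exists_affine_of_tendsto hG (H := fun n x => F (a n * x + d n) ^ n)
      (a := fun n => a (n * k) / a n) (d := fun n => (d (n * k) - d n) / a n)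
      (fun n x y hxy => ?_) (fun n x => pow_nonneg (hF0 _) _) (fun n => div_pos (ha _) (ha _)) hk
      h fun x => ?_
    · have := mul_le_mul_of_nonneg_left hxy (ha n).le
      exact pow_le_pow_left₀ (hF0 _) (hF (by linarith)) n
    · refine ((h x).comp (tendsto_id.atTop_mul_const' (Nat.pos_of_ne_zero hk))).congr fun n => ?_
      have := (ha n).ne'
      simp only [Function.comp, id, pow_mul]
      congr 3
      field_simp
      ring
  obtain ⟨x₀, hx0, hx1⟩ := exists_cdf_mem_Ioo G hG
  have hlog : Real.log (cdf G x₀) < 0 := Real.log_neg hx0 hx1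
  have hlogp : Real.log p < Real.log q := Real.log_lt_log hp hpq
  have hlogq : Real.log q ≤ 0 := Real.log_nonpos (hp.trans hpq).le hq
  obtain ⟨r, hr1, hr2⟩ := exists_rat_btwn
    (show Real.log q / Real.log (cdf G x₀) < Real.log p / Real.log (cdf G x₀) from
      div_lt_div_of_neg_of_lt hlog hlogp)
  have hr0 : (0 : ℝ) < r := (div_nonneg_of_nonpos hlogq hlog.le).trans_lt hr1
  have hr0' : 0 < r := by exact_mod_cast hr0
  obtain ⟨k, hk⟩ : ∃ k : ℕ, r.num = k := Int.eq_ofNat_of_zero_le (Rat.num_nonneg.2 hr0'.le)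
  have hk0 : k ≠ 0 := by
    rintro rfl
    exact (Rat.num_pos.2 hr0').ne' hk
  have hreq : (r : ℝ) = k / r.den := by
    rw [Rat.cast_def, hk]; simp
  obtain ⟨A, B, -, hAB⟩ := hstab r.den r.den_nz
  obtain ⟨A', B', hA', hAB'⟩ := hstab k hk0
  set y := A * x₀ + B with hy
  have hym : cdf G y ^ r.den = cdf G x₀ := hAB x₀
  have hz : cdf G ((y - B') / A') = cdf G y ^ k := by
    rw [← hAB' ((y - B') / A'), mul_div_cancel₀ _ hA'.ne', sub_add_cancel]
  have hy0 : 0 < cdf G y := by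
    refine lt_of_le_of_ne (cdf_nonneg G y) fun h0 => ?_
    rw [← h0, zero_pow r.den_nz] at hym
    exact hx0.ne hym
  have hlogz : Real.log (cdf G ((y - B') / A')) = r * Real.log (cdf G x₀) := by
    rw [hz, ← hym, Real.log_pow, Real.log_pow, hreq]
    have : (r.den : ℝ) ≠ 0 := by exact_mod_cast r.den_nz
    field_simp
  have hz0 : 0 < cdf G ((y - B') / A') := by rw [hz]; positivity
  refine ⟨(y - B') / A', ?_, ?_⟩
  · rw [← Real.log_lt_log_iff hp hz0, hlogz]
    rwa [lt_div_iff_of_neg hlog] at hr2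
  · rw [← Real.log_lt_log_iff hz0 (hp.trans hpq), hlogz]
    rwa [div_lt_iff_of_neg hlog] at hr1

end

/-! ### High levels and the extremal index -/

section

variable {Ω : Type*} [MeasurableSpace Ω] {μ : Measure Ω} {X : ℕ → Ω → ℝ} {θ : ℝ}

/-- The probability that none of the first `n` events after time `0` exceeds the level `u`. -/
noncomputable def noExceedProb (X : ℕ → Ω → ℝ) (μ : Measure Ω) (u : ℝ) (n : ℕ) : ℝ :=
  μ.real {ω | ∀ i < n, X (i + 1) ω ≤ u}

lemma noExceedProb_nonneg (u : ℝ) (n : ℕ) : 0 ≤ noExceedProb X μ u n := measureReal_nonneg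

lemma ciSup_fin_le_iff {n : ℕ} (hn : n ≠ 0) (y : Fin n → ℝ) (u : ℝ) :
    ⨆ i, y i ≤ u ↔ ∀ i, y i ≤ u := by
  have : Nonempty (Fin n) := ⟨⟨0, Nat.pos_of_ne_zero hn⟩⟩
  exact ciSup_le_iff (Set.finite_range y).bddAbove

lemma real_partialMax_le {n : ℕ} (hn : n ≠ 0) {a d : ℝ} (ha : 0 < a) (x : ℝ) :
    μ.real {ω | (partialMax X n ω - d) / a ≤ x} = noExceedProb X μ (a * x + d) n := by
  rw [noExceedProb]
  congr 1
  ext ω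
  simp only [Set.mem_ofPred_eq]
  rw [div_le_iff₀ ha, sub_le_iff_le_add, mul_comm, partialMax, ciSup_fin_le_iff hn,
    Fin.forall_iff]

variable [IsProbabilityMeasure μ]

lemma noExceedProb_zero (u : ℝ) : noExceedProb X μ u 0 = 1 := by
  simp [noExceedProb]

lemma noExceedProb_le_one (u : ℝ) (n : ℕ) : noExceedProb X μ u n ≤ 1 := measureReal_le_one

lemma noExceedProb_mono (n : ℕ) : Monotone fun u => noExceedProb X μ u n :=
  fun _ _ h => measureReal_mono fun _ hω i hi => (hω i hi).trans h

lemma cdf_map_eq (hX : Measurable (X 0)) (x : ℝ) :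
    cdf (μ.map (X 0)) x = 1 - exceedProb X μ x := by
  have : IsProbabilityMeasure (μ.map (X 0)) := Measure.isProbabilityMeasure_map hX.aemeasurable
  rw [cdf_eq_real, map_measureReal_apply hX measurableSet_Iic, exceedProb,
    ← probReal_compl_eq_one_sub (measurableSet_lt measurable_const hX)]
  congr 1; ext ω; simp

lemma pi_real_maximum_le (hX : Measurable (X 0)) {n : ℕ} (hn : n ≠ 0) {a d : ℝ} (ha : 0 < a)
    (x : ℝ) :
    (Measure.pi fun _ : Fin n => μ.map (X 0)).real {y : Fin n → ℝ | ((⨆ i, y i) - d) / a ≤ x}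
      = cdf (μ.map (X 0)) (a * x + d) ^ n := by
  have : IsProbabilityMeasure (μ.map (X 0)) := Measure.isProbabilityMeasure_map hX.aemeasurable
  have hset : {y : Fin n → ℝ | ((⨆ i, y i) - d) / a ≤ x} =
      Set.univ.pi fun _ => Set.Iic (a * x + d) := by
    ext y
    simp only [Set.mem_ofPred_eq, Set.mem_univ_pi, Set.mem_Iic]
    rw [← ciSup_fin_le_iff hn, div_le_iff₀ ha, sub_le_iff_le_add, mul_comm]
  rw [hset, measureReal_def, Measure.pi_pi, Finset.prod_const, Finset.card_univ, Fintype.card_fin,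
    ENNReal.toReal_pow, cdf_eq_real, measureReal_def]

/-- The extremal index hypothesis in terms of the distribution function of `X 0` and of the
probabilities of no exceedance. -/
lemma HasExtremalIndex.exists_norming (hX : Measurable (X 0)) (h : HasExtremalIndex X μ θ) :
    ∃ (a d : ℕ → ℝ) (G : ProbabilityMeasure ℝ), (∀ n, 0 < a n) ∧
      (∀ c : ℝ, (G : Measure ℝ) ≠ Measure.dirac c) ∧
      (∀ x, Tendsto (fun n => cdf (μ.map (X 0)) (a n * x + d n) ^ n) atTop
        (𝓝 (cdf (G : Measure ℝ) x))) ∧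
      (∀ x, Tendsto (fun n => noExceedProb X μ (a n * x + d n) n) atTop
        (𝓝 (cdf (G : Measure ℝ) x ^ θ))) := by
  obtain ⟨a, d, G, ha, hG, h1, h2⟩ := h
  refine ⟨a, d, G, ha, hG, fun x => (h1 x).congr' ?_, fun x => (h2 x).congr' ?_⟩
  · filter_upwards [eventually_ne_atTop 0] with n hn using pi_real_maximum_le hX hn (ha n) x
  · filter_upwards [eventually_ne_atTop 0] with n hn using real_partialMax_le hn (ha n) x

lemma real_le_eq (hX : Measurable (X 0)) (x : ℝ) :
    μ.real {ω | X 0 ω ≤ x} = 1 - exceedProb X μ x := by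
  rw [exceedProb, ← probReal_compl_eq_one_sub (measurableSet_lt measurable_const hX)]
  congr 1; ext ω; simp

lemma exceedProb_anti : Antitone (exceedProb X μ) := fun _ _ h =>
  measureReal_mono fun _ hω => lt_of_le_of_lt h hω

/-- Exceedance probabilities vanish in the limit at the right endpoint: membership in a maximum
domain of attraction excludes an atom there. -/
theorem tendsto_exceedProb (hX : Measurable (X 0)) (h : HasExtremalIndex X μ θ) :
    Tendsto (exceedProb X μ) (leftLimit (rightEndpoint X μ)) (𝓝[>] 0) := by
  obtain ⟨a, d, G, ha, hG, h1, -⟩ := h.exists_norming hX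
  have : IsProbabilityMeasure (μ.map (X 0)) := Measure.isProbabilityMeasure_map hX.aemeasurable
  set F := cdf (μ.map (X 0)) with hF
  have hFeq : ∀ x, F x = 1 - exceedProb X μ x := cdf_map_eq hX
  have hmem : ∀ x, F x < 1 → (x : EReal) ≤ rightEndpoint X μ := by
    intro x hx
    refine le_sSup ⟨x, ?_, rfl⟩
    change μ.real {ω | X 0 ω ≤ x} < 1
    rwa [real_le_eq hX, ← hFeq]
  have hlt : ∀ x, F x < 1 → (x : EReal) < rightEndpoint X μ := by
    intro x hx
    have hr : Tendsto F (𝓝[>] x) (𝓝 (F x)) :=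
      (F.right_continuous x).mono_left (nhdsWithin_mono _ Set.Ioi_subset_Ici_self)
    obtain ⟨y, hy, hxy⟩ := ((hr.eventually_lt_const hx).and self_mem_nhdsWithin).exists
    have hxy' : x < y := hxy
    exact (EReal.coe_lt_coe_iff.2 hxy').trans_le (hmem y hy)
  have hbelow : ∀ᶠ u : ℝ in leftLimit (rightEndpoint X μ), (u : EReal) < rightEndpoint X μ :=
    preimage_mem_comap (self_mem_nhdsWithin (s := Set.Iio (rightEndpoint X μ)))
  have habove : ∀ x, F x < 1 → ∀ᶠ u in leftLimit (rightEndpoint X μ), x < u := by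
    intro x hx
    have : ∀ᶠ u : ℝ in leftLimit (rightEndpoint X μ), (x : EReal) < (u : EReal) :=
      preimage_mem_comap (mem_nhdsWithin_of_mem_nhds (Ioi_mem_nhds (hlt x hx)))
    filter_upwards [this] with u hu using EReal.coe_lt_coe_iff.1 hu
  refine tendsto_nhdsWithin_iff.2 ⟨tendsto_order.2 ⟨fun c hc => ?_, fun c hc => ?_⟩, ?_⟩
  · exact Eventually.of_forall fun u => hc.trans_le measureReal_nonneg
  · obtain ⟨x₀, hx0, hx1⟩ := exists_cdf_mem_Ioo (G : Measure ℝ) hG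
    have hc1 : 0 ≤ max (1 - c) 0 ∧ max (1 - c) 0 < 1 := ⟨le_max_right _ _, by
      rw [max_lt_iff]; constructor <;> linarith⟩
    obtain ⟨n, hn1, hn2⟩ := (((h1 x₀).eventually_lt_const hx1).and
      ((tendsto_pow_atTop_nhds_zero_of_lt_one hc1.1 hc1.2).eventually_lt (h1 x₀) hx0)).exists
    have hv1 : F (a n * x₀ + d n) < 1 := by
      by_contra hge
      rw [le_antisymm (cdf_le_one _ _) (not_lt.1 hge), one_pow] at hn1
      exact lt_irrefl _ hn1
    have hv2 : 1 - c < F (a n * x₀ + d n) :=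
      (le_max_left _ _).trans_lt (lt_of_pow_lt_pow_left₀ n (cdf_nonneg _ _) hn2)
    filter_upwards [habove _ hv1] with u hu
    refine (exceedProb_anti hu.le).trans_lt ?_
    rw [hFeq] at hv2
    linarith
  · filter_upwards [hbelow] with u hu
    obtain ⟨_, ⟨x, hx, rfl⟩, hux⟩ := lt_sSup_iff.1 hu
    have hux' : u < x := EReal.coe_lt_coe_iff.1 hux
    have hx' : 1 - exceedProb X μ x < 1 := by
      rw [← real_le_eq hX]; exact hx
    have := exceedProb_anti (X := X) (μ := μ) hux'.le
    change 0 < exceedProb X μ u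
    linarith

lemma tendsto_one_sub_pow {ι : Type*} {l : Filter ι} {p : ι → ℝ} {N : ι → ℕ} {t : ℝ}
    (hp : Tendsto p l (𝓝[>] 0)) (hN : Tendsto (fun i => (N i : ℝ) * p i) l (𝓝 t)) :
    Tendsto (fun i => (1 - p i) ^ N i) l (𝓝 (Real.exp (-t))) := by
  have hd : HasDerivAt (fun x : ℝ => Real.log (1 - x)) (-1) 0 := by
    have := ((hasDerivAt_id (0 : ℝ)).const_sub 1).log (by simp)
    simpa using this
  have hs := hd.tendsto_slope_zero_right.comp hp
  have h2 := (hN.mul hs).rexp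
  rw [mul_neg_one] at h2
  have hsmall : ∀ᶠ i in l, p i ∈ Set.Ioo (0 : ℝ) 1 := hp.eventually (Ioo_mem_nhdsGT one_pos)
  refine h2.congr' ?_
  filter_upwards [hsmall] with i hi
  have h1 : 0 < 1 - p i := by linarith [hi.2]
  have h0 := hi.1.ne'
  simp only [Function.comp, zero_add, sub_zero, Real.log_one, smul_eq_mul]
  rw [show (N i : ℝ) * p i * ((p i)⁻¹ * Real.log (1 - p i)) = N i * Real.log (1 - p i) by
    field_simp, ← Real.log_pow, Real.exp_log (pow_pos h1 _)]

/-- If `n` grows like `t / P (X 0 > u)`, then `P (X 1, …, X n ≤ u)` tends to `exp (-θ t)`. The level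
`u` is compared with normalized levels `a n * x + d n` by comparing the probabilities that `n`
independent copies stay below; the range of `G` is dense enough to make the two bounds meet. -/
theorem tendsto_noExceedProb (hX : Measurable (X 0)) (hθ0 : 0 < θ) (h : HasExtremalIndex X μ θ)
    {ι : Type*} {l : Filter ι} {u : ι → ℝ} {N : ι → ℕ} {t : ℝ} (ht : 0 < t)
    (hp : Tendsto (fun i => exceedProb X μ (u i)) l (𝓝[>] 0))
    (hN : Tendsto (fun i => (N i : ℝ) * exceedProb X μ (u i)) l (𝓝 t)) :
    Tendsto (fun i => noExceedProb X μ (u i) (N i)) l (𝓝 (Real.exp (-(θ * t)))) := by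
  obtain ⟨a, d, G, ha, hG, h1, h2⟩ := h.exists_norming hX
  have : IsProbabilityMeasure (μ.map (X 0)) := Measure.isProbabilityMeasure_map hX.aemeasurable
  set F := cdf (μ.map (X 0)) with hF
  have hFeq : ∀ x, F x = 1 - exceedProb X μ x := cdf_map_eq hX
  have hFmono : Monotone F := monotone_cdf _
  have hFN : Tendsto (fun i => F (u i) ^ N i) l (𝓝 (Real.exp (-t))) := by
    simp_rw [hFeq]
    exact tendsto_one_sub_pow hp hN
  have hNtop : Tendsto N l atTop := by
    have h3 : Tendsto (fun i => (N i : ℝ) * exceedProb X μ (u i) * (exceedProb X μ (u i))⁻¹) l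
        atTop := hN.pos_mul_atTop ht (tendsto_inv_nhdsGT_zero.comp hp)
    refine tendsto_natCast_atTop_iff.1 (h3.congr' ?_)
    filter_upwards [hp.eventually self_mem_nhdsWithin] with i hi
    have hi' : 0 < exceedProb X μ (u i) := hi
    rw [mul_assoc, mul_inv_cancel₀ hi'.ne', mul_one]
  have hexp : Real.exp (-(θ * t)) = Real.exp (-t) ^ θ := by
    rw [← Real.exp_mul]; ring_nf
  have het : 0 < Real.exp (-t) := Real.exp_pos _
  have het1 : Real.exp (-t) < 1 := Real.exp_lt_one_iff.2 (by linarith)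
  have hcont : Tendsto (fun r : ℝ => r ^ θ) (𝓝 (Real.exp (-t))) (𝓝 (Real.exp (-t) ^ θ)) :=
    Real.continuousAt_rpow_const _ θ (Or.inl het.ne')
  rw [hexp]
  refine tendsto_order.2 ⟨fun c hc => ?_, fun c hc => ?_⟩
  · obtain ⟨r, hcr, hr0, hr1⟩ : ∃ r, c < r ^ θ ∧ 0 < r ∧ r < Real.exp (-t) :=
      (((hcont.mono_left nhdsWithin_le_nhds).eventually_const_lt hc).and
        (Ioo_mem_nhdsLT het)).exists
    obtain ⟨x, hx1, hx2⟩ := exists_cdf_mem_Ioo_of_tendsto_pow hFmono (cdf_nonneg _) ha hG h1 hr0 hr1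
      het1.le
    have hcx : c < cdf (G : Measure ℝ) x ^ θ := hcr.trans (Real.rpow_lt_rpow hr0.le hx1 hθ0)
    filter_upwards [((h1 x).comp hNtop).eventually_lt hFN hx2,
      ((h2 x).comp hNtop).eventually_const_lt hcx] with i hi1 hi2
    have hlt : a (N i) * x + d (N i) < u i :=
      hFmono.reflect_lt (lt_of_pow_lt_pow_left₀ _ (cdf_nonneg _ _) hi1)
    exact hi2.trans_le (noExceedProb_mono _ hlt.le)
  · obtain ⟨r, hcr, hr0, hr1⟩ : ∃ r, r ^ θ < c ∧ Real.exp (-t) < r ∧ r < 1 :=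
      (((hcont.mono_left nhdsWithin_le_nhds).eventually_lt_const hc).and
        (Ioo_mem_nhdsGT het1)).exists
    obtain ⟨x, hx1, hx2⟩ := exists_cdf_mem_Ioo_of_tendsto_pow hFmono (cdf_nonneg _) ha hG h1 het hr0
      hr1.le
    have hcx : cdf (G : Measure ℝ) x ^ θ < c :=
      (Real.rpow_lt_rpow (het.trans hx1).le hx2 hθ0).trans hcr
    filter_upwards [hFN.eventually_lt ((h1 x).comp hNtop) hx1,
      ((h2 x).comp hNtop).eventually_lt_const hcx] with i hi1 hi2
    have hlt : u i < a (N i) * x + d (N i) :=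
      hFmono.reflect_lt (lt_of_pow_lt_pow_left₀ _ (cdf_nonneg _ _) hi1)
    exact (noExceedProb_mono _ hlt.le).trans_lt hi2

end

/-! ### The first exceedance after an exceedance -/

section

lemma firstExceedance_eq_succ_iff {Ω : Type*} {X : ℕ → Ω → ℝ} {u : ℝ} {ω : Ω} {k : ℕ} :
    firstExceedance X u ω = k + 1 ↔ (∀ i < k, X (i + 1) ω ≤ u) ∧ u < X (k + 1) ω := by
  constructor
  · intro h
    have hne : {k : ℕ | 1 ≤ k ∧ u < X k ω}.Nonempty :=
      Nat.nonempty_of_pos_sInf (by rw [firstExceedance] at h; omega)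
    have hmem := Nat.sInf_mem hne
    rw [← firstExceedance, h] at hmem
    refine ⟨fun i hi => ?_, hmem.2⟩
    by_contra hlt
    have := Nat.sInf_le (s := {k : ℕ | 1 ≤ k ∧ u < X k ω}) (m := i + 1)
      ⟨by omega, not_le.1 hlt⟩
    rw [← firstExceedance, h] at this
    omega
  · rintro ⟨h1, h2⟩
    have hmem : k + 1 ∈ {k : ℕ | 1 ≤ k ∧ u < X k ω} := ⟨by omega, h2⟩
    refine le_antisymm (Nat.sInf_le hmem) (le_csInf ⟨_, hmem⟩ ?_)
    rintro j ⟨hj1, hj2⟩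
    by_contra hlt
    have := h1 (j - 1) (by omega)
    rw [Nat.sub_add_cancel hj1] at this
    exact absurd hj2 (not_lt.2 this)

/-- The event that there is an exceedance at time `0`, and none at the times `1, …, k`. -/
def survivalSet {Ω : Type*} (X : ℕ → Ω → ℝ) (u : ℝ) (k : ℕ) : Set Ω :=
  {ω | u < X 0 ω ∧ ∀ i < k, X (i + 1) ω ≤ u}

lemma survivalSet_succ_subset {Ω : Type*} {X : ℕ → Ω → ℝ} (u : ℝ) (k : ℕ) :
    survivalSet X u (k + 1) ⊆ survivalSet X u k :=
  fun _ h => ⟨h.1, fun i hi => h.2 i (by omega)⟩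

variable {Ω : Type*} [MeasurableSpace Ω] {μ : Measure Ω} {X : ℕ → Ω → ℝ}

lemma measurable_firstExceedance (hX : ∀ n, Measurable (X n)) (u : ℝ) :
    Measurable (firstExceedance X u) := by
  have hsucc : ∀ k : ℕ, MeasurableSet (firstExceedance X u ⁻¹' {k + 1}) := by
    intro k
    have : firstExceedance X u ⁻¹' {k + 1} =
        (⋂ i ∈ Finset.range k, {ω | X (i + 1) ω ≤ u}) ∩ {ω | u < X (k + 1) ω} := by
      ext ω
      simp [firstExceedance_eq_succ_iff]
    rw [this]
    exact (Finset.measurableSet_biInter _ fun i _ => measurableSet_le (hX _) measurable_const).inter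
      (measurableSet_lt measurable_const (hX _))
  refine measurable_to_countable' fun n => ?_
  cases n with
  | succ k => exact hsucc k
  | zero =>
    have : firstExceedance X u ⁻¹' {0} = (⋃ k : ℕ, firstExceedance X u ⁻¹' {k + 1})ᶜ := by
      ext ω
      simp only [Set.mem_preimage, Set.mem_singleton_iff, Set.mem_compl_iff, Set.mem_iUnion,
        not_exists]
      constructor
      · intro h k; omega
      · intro h
        by_contra h0
        obtain ⟨k, hk⟩ := Nat.exists_eq_succ_of_ne_zero h0
        exact h k hk
    rw [this]
    exact (MeasurableSet.iUnion hsucc).compl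

lemma measurable_returnTime {T : ℕ → Ω → ℝ} (hX : ∀ n, Measurable (X n))
    (hT : ∀ n, Measurable (T n)) (u : ℝ) : Measurable (returnTime X T u) := by
  have : Measurable fun p : ℕ × Ω => T p.1 p.2 := measurable_from_prod_countable_right hT
  exact this.comp ((measurable_firstExceedance hX u).prodMk measurable_id)

lemma measurableSet_forall_le (hX : ∀ n, Measurable (X n)) (u : ℝ) (k : ℕ) :
    MeasurableSet {ω | ∀ i < k, X (i + 1) ω ≤ u} := by
  have : {ω | ∀ i < k, X (i + 1) ω ≤ u} = ⋂ i ∈ Finset.range k, {ω | X (i + 1) ω ≤ u} := by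
    ext ω; simp
  rw [this]
  exact Finset.measurableSet_biInter _ fun i _ => measurableSet_le (hX _) measurable_const

lemma measurableSet_survivalSet (hX : ∀ n, Measurable (X n)) (u : ℝ) (k : ℕ) :
    MeasurableSet (survivalSet X u k) :=
  (measurableSet_lt measurable_const (hX 0)).inter (measurableSet_forall_le hX u k)

variable [IsProbabilityMeasure μ]

/-- By stationarity the law of the first exceedance time after an exceedance is a discrete
derivative of `k ↦ P (X 1, …, X k ≤ u)`. -/
lemma real_survivalSet (hX : ∀ n, Measurable (X n)) (hstat : IsStrictlyStationary X μ) (u : ℝ)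
    (k : ℕ) : μ.real (survivalSet X u k) = noExceedProb X μ u k - noExceedProb X μ u (k + 1) := by
  have hmeas : MeasurableSet {x : ℕ → ℝ | ∀ i < k + 1, x i ≤ u} := by
    have : {x : ℕ → ℝ | ∀ i < k + 1, x i ≤ u} =
        ⋂ i ∈ Finset.range (k + 1), {x : ℕ → ℝ | x i ≤ u} := by
      ext x; simp
    rw [this]
    exact Finset.measurableSet_biInter _ fun i _ =>
      measurableSet_le (measurable_pi_apply i) measurable_const
  have hshift : noExceedProb X μ u (k + 1) = μ.real {ω | ∀ i < k + 1, X i ω ≤ u} :=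
    congrArg ENNReal.toReal ((hstat 1).measure_mem_eq hmeas)
  have hset : survivalSet X u k =
      {ω | ∀ i < k, X (i + 1) ω ≤ u} \ {ω | ∀ i < k + 1, X i ω ≤ u} := by
    ext ω
    simp only [survivalSet, Set.mem_ofPred_eq, Set.mem_sdiff]
    constructor
    · rintro ⟨h0, h⟩
      exact ⟨h, fun h' => absurd h0 (not_lt.2 (h' 0 (by omega)))⟩
    · rintro ⟨h, h'⟩
      refine ⟨?_, h⟩
      by_contra h0
      refine h' fun i hi => ?_
      cases i with
      | zero => exact not_lt.1 h0
      | succ i => exact h i (by omega)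
  have hmeas' : MeasurableSet {ω | ∀ i < k + 1, X i ω ≤ u} :=
    (measurable_pi_lambda (fun ω n => X n ω) hX) hmeas
  rw [hset, measureReal_sdiff ?_ hmeas', ← hshift]
  · rfl
  · intro ω h i hi
    exact h (i + 1) (by omega)

lemma noExceedProb_antitone (u : ℝ) :
    Antitone (noExceedProb X μ u) := by
  refine antitone_nat_of_succ_le fun k => measureReal_mono fun ω h i hi => h i (by omega)

/-- Recurrence: a stationary sequence that exceeds a level at time `0` almost surely exceeds it
again. -/
theorem measure_forall_survivalSet (hX : ∀ n, Measurable (X n)) (hstat : IsStrictlyStationary X μ)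
    (u : ℝ) : μ (⋂ k, survivalSet X u k) = 0 := by
  have hlim : ∃ L, Tendsto (noExceedProb X μ u) atTop (𝓝 L) :=
    ⟨_, tendsto_atTop_ciInf (noExceedProb_antitone u) ⟨0, by
      rintro _ ⟨k, rfl⟩; exact noExceedProb_nonneg u k⟩⟩
  obtain ⟨L, hL⟩ := hlim
  have h0 : Tendsto (fun k => μ.real (survivalSet X u k)) atTop (𝓝 0) := by
    simp_rw [real_survivalSet hX hstat]
    simpa using hL.sub (hL.comp (tendsto_add_atTop_nat 1))
  have : μ.real (⋂ k, survivalSet X u k) ≤ 0 :=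
    ge_of_tendsto' h0 fun k => measureReal_mono (Set.iInter_subset _ k)
  exact (measureReal_eq_zero_iff).1 (le_antisymm this measureReal_nonneg)

lemma ae_exists_exceedance (hX : ∀ n, Measurable (X n)) (hstat : IsStrictlyStationary X μ)
    (u : ℝ) : ∀ᵐ ω ∂μ, u < X 0 ω → ∃ k : ℕ, 1 ≤ k ∧ u < X k ω := by
  rw [ae_iff]
  refine measure_mono_null (fun ω hω => ?_) (measure_forall_survivalSet hX hstat u)
  simp only [Set.mem_ofPred_eq] at hω
  push Not at hω
  exact Set.mem_iInter.2 fun k => ⟨hω.1, fun i _ => hω.2 (i + 1) (by omega)⟩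

/-! ### Limits of generating functions -/

/-- Two summations by parts in the generating function of the first exceedance time. -/
lemma hasSum_generating {g : ℕ → ℝ} (hg0 : g 0 = 1) (hg : ∀ k, 0 ≤ g k) (hg1 : ∀ k, g k ≤ 1)
    {z : ℝ} (hz0 : 0 ≤ z) (hz1 : z < 1) :
    HasSum (fun k => z ^ (k + 1) * ((g k - g (k + 1)) - (g (k + 1) - g (k + 2))))
      ((1 - g 1) - (1 - z) * (1 - (1 - z) * ∑' k, z ^ k * g (k + 1))) := by
  have hsum : ∀ j, Summable fun k => z ^ k * g (k + j) := fun j =>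
    Summable.of_nonneg_of_le (fun k => mul_nonneg (pow_nonneg hz0 k) (hg _))
      (fun k => mul_le_of_le_one_right (pow_nonneg hz0 k) (hg1 _))
      (summable_geometric_of_lt_one hz0 hz1)
  have e0 : ∑' k, z ^ k * g k = 1 + z * ∑' k, z ^ k * g (k + 1) := by
    have h0 : Summable fun k => z ^ k * g k := hsum 0
    rw [h0.tsum_eq_zero_add, ← tsum_mul_left]
    simp only [pow_zero, one_mul, hg0, pow_succ]
    congr 2; ext k; ring
  have e1 : ∑' k, z ^ k * g (k + 1) = g 1 + z * ∑' k, z ^ k * g (k + 2) := by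
    rw [(hsum 1).tsum_eq_zero_add, ← tsum_mul_left]
    simp only [pow_zero, one_mul, pow_succ, zero_add]
    congr 2; ext k; ring_nf
  have h := (((hsum 0).hasSum.sub ((hsum 1).hasSum.mul_left 2)).add (hsum 2).hasSum).mul_left z
  simp only [add_zero] at h
  have hval : (1 - g 1) - (1 - z) * (1 - (1 - z) * ∑' k, z ^ k * g (k + 1)) =
      z * (∑' k, z ^ k * g k - 2 * ∑' k, z ^ k * g (k + 1) + ∑' k, z ^ k * g (k + 2)) := by
    linear_combination e1 - z * e0
  rw [hval]
  refine h.congr_fun fun k => ?_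
  ring

lemma map_natFloor_volume :
    (volume.restrict (Set.Ioi (0 : ℝ))).map (Nat.floor : ℝ → ℕ) = Measure.count := by
  refine Measure.ext_of_singleton fun n => ?_
  rw [Measure.map_apply Nat.measurable_floor (measurableSet_singleton n),
    restrict_Ioi_eq_restrict_Ici, Measure.restrict_apply
      (Nat.measurable_floor (measurableSet_singleton n)), Measure.count_singleton]
  have : (Nat.floor : ℝ → ℕ) ⁻¹' {n} ∩ Set.Ici 0 = Set.Ico (n : ℝ) (n + 1) := by
    ext x
    simp only [Set.mem_inter_iff, Set.mem_preimage, Set.mem_singleton_iff, Set.mem_Ici, Set.mem_Ico]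
    constructor
    · rintro ⟨h, hx⟩; exact (Nat.floor_eq_iff hx).1 h
    · intro h
      have hx : 0 ≤ x := (Nat.cast_nonneg n).trans h.1
      exact ⟨(Nat.floor_eq_iff hx).2 h, hx⟩
  rw [this, Real.volume_Ico]
  simp

lemma tsum_eq_integral_natFloor {f : ℕ → ℝ} (hf : Summable fun k => ‖f k‖) {p : ℝ} (hp : 0 < p) :
    ∑' k, f k = p⁻¹ * ∫ t in Set.Ioi (0 : ℝ), f ⌊t / p⌋₊ := by
  have h1 : ∑' k, f k = ∫ x in Set.Ioi (0 : ℝ), f ⌊x⌋₊ := by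
    rw [← integral_map (φ := (Nat.floor : ℝ → ℕ)) Nat.measurable_floor.aemeasurable
      (measurable_of_countable f).aestronglyMeasurable, map_natFloor_volume,
      integral_countable (integrable_count_iff.2 hf)]
    simp [measureReal_def]
  have h2 := integral_comp_mul_left_Ioi (fun x => f ⌊x⌋₊) 0 (inv_pos.2 hp)
  rw [mul_zero, inv_inv, smul_eq_mul] at h2
  rw [h1]
  simp_rw [div_eq_inv_mul]
  rw [h2, inv_mul_cancel_left₀ hp.ne']

/-- If `g i ⌊t / p⌋ → exp (-θ t)` as `p → 0` and `1 - z ~ q p`, then the Abel means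
`(1 - z) ∑ z ^ k g i (k + 1)` converge to `∫ q exp (-q t) exp (-θ t) dt = q / (q + θ)`. -/
theorem tendsto_abel_mean {ι : Type*} {l : Filter ι} [l.IsCountablyGenerated] {g : ι → ℕ → ℝ}
    (hg : ∀ i k, 0 ≤ g i k) (hg1 : ∀ i k, g i k ≤ 1) {p z : ι → ℝ} {q θ : ℝ} (hq : 0 < q)
    (hθ : 0 < θ) (hp : Tendsto p l (𝓝[>] 0)) (hz : ∀ i, 0 ≤ z i)
    (hzp : Tendsto (fun i => (1 - z i) / p i) l (𝓝 q))
    (hlim : ∀ t, 0 < t → ∀ N : ι → ℕ, Tendsto (fun i => (N i : ℝ) * p i) l (𝓝 t) →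
      Tendsto (fun i => g i (N i)) l (𝓝 (Real.exp (-(θ * t))))) :
    Tendsto (fun i => (1 - z i) * ∑' k, z i ^ k * g i (k + 1)) l (𝓝 (q / (q + θ))) := by
  have hp0 : Tendsto p l (𝓝 0) := hp.mono_right nhdsWithin_le_nhds
  have hppos : ∀ᶠ i in l, 0 < p i := hp.eventually self_mem_nhdsWithin
  have hw : Tendsto (fun i => 1 - z i) l (𝓝[>] 0) := by
    refine tendsto_nhdsWithin_iff.2 ⟨?_, ?_⟩
    · have := hzp.mul hp0
      rw [mul_zero] at this
      refine this.congr' ?_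
      filter_upwards [hppos] with i hi using div_mul_cancel₀ _ hi.ne'
    · filter_upwards [hppos, hzp.eventually_const_lt hq] with i hi hi2
      exact (div_pos_iff_of_pos_right hi).1 hi2
  have hw0 : ∀ᶠ i in l, 0 < 1 - z i := hw.eventually self_mem_nhdsWithin
  have hfl : ∀ t : ℝ, 0 < t → Tendsto (fun i => (⌊t / p i⌋₊ : ℝ) * p i) l (𝓝 t) := by
    intro t ht
    have h1 : Tendsto (fun i => t / p i) l atTop := by
      simp_rw [div_eq_mul_inv]
      exact (tendsto_inv_nhdsGT_zero.comp hp).const_mul_atTop ht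
    have h2 := ((tendsto_nat_floor_div_atTop (R := ℝ)).comp h1).mul_const t
    rw [one_mul] at h2
    refine h2.congr' ?_
    filter_upwards [hppos] with i hi
    simp only [Function.comp]
    field_simp
  have hfl1 : ∀ t : ℝ, 0 < t → Tendsto (fun i => ((⌊t / p i⌋₊ + 1 : ℕ) : ℝ) * p i) l (𝓝 t) := by
    intro t ht
    have := (hfl t ht).add hp0
    rw [add_zero] at this
    refine this.congr fun i => ?_
    push_cast; ring
  have hEq : (fun i => (1 - z i) * ∑' k, z i ^ k * g i (k + 1)) =ᶠ[l] fun i =>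
      ∫ t in Set.Ioi (0 : ℝ), (1 - z i) / p i *
        (z i ^ ⌊t / p i⌋₊ * g i (⌊t / p i⌋₊ + 1)) := by
    filter_upwards [hppos, hw0] with i hi hwi
    have hs : Summable fun k => ‖z i ^ k * g i (k + 1)‖ := by
      refine Summable.of_nonneg_of_le (fun k => norm_nonneg _) (fun k => ?_)
        (summable_geometric_of_lt_one (hz i) (by linarith))
      rw [Real.norm_of_nonneg (mul_nonneg (pow_nonneg (hz i) k) (hg _ _))]
      exact mul_le_of_le_one_right (pow_nonneg (hz i) k) (hg1 _ _)
    rw [tsum_eq_integral_natFloor hs hi, integral_const_mul, div_eq_mul_inv, mul_assoc]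
  rw [tendsto_congr' hEq]
  have hval : ∫ t in Set.Ioi (0 : ℝ), q * (Real.exp (-(t * q)) * Real.exp (-(θ * t)))
      = q / (q + θ) := by
    have : ∀ t : ℝ, Real.exp (-(t * q)) * Real.exp (-(θ * t)) = Real.exp (-(q + θ) * t) := by
      intro t; rw [← Real.exp_add]; ring_nf
    simp_rw [this]
    rw [integral_const_mul, integral_exp_mul_Ioi (by linarith)]
    rw [mul_zero, Real.exp_zero, neg_div_neg_eq, mul_one_div]
  rw [← hval]
  refine tendsto_integral_filter_of_dominated_convergence
    (fun t => 2 * q * (Real.exp 1 * Real.exp (-(q / 2) * t))) ?_ ?_ ?_ ?_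
  · refine Eventually.of_forall fun i => Measurable.aestronglyMeasurable ?_
    have : Measurable fun t : ℝ => ⌊t / p i⌋₊ := by fun_prop
    exact ((measurable_of_countable fun k : ℕ => z i ^ k * g i (k + 1)).comp this).const_mul _
  · filter_upwards [hppos, hw0, hw.eventually (Ioo_mem_nhdsGT one_pos),
      hzp.eventually_lt_const (show q < 2 * q by linarith),
      hzp.eventually_const_lt (show q / 2 < q by linarith)] with i hpi hwi hwi1 h1 h2
    refine (ae_restrict_mem measurableSet_Ioi).mono fun t ht => ?_
    have ht' : 0 < t := ht
    have hzg := mul_nonneg (pow_nonneg (hz i) ⌊t / p i⌋₊) (hg i (⌊t / p i⌋₊ + 1))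
    rw [Real.norm_of_nonneg (mul_nonneg (div_nonneg hwi.le hpi.le) hzg)]
    refine mul_le_mul h1.le ?_ hzg (by positivity)
    calc z i ^ ⌊t / p i⌋₊ * g i (⌊t / p i⌋₊ + 1) ≤ z i ^ ⌊t / p i⌋₊ :=
          mul_le_of_le_one_right (pow_nonneg (hz i) _) (hg1 _ _)
      _ ≤ Real.exp (-(1 - z i)) ^ ⌊t / p i⌋₊ := by
          refine pow_le_pow_left₀ (hz i) ?_ _
          have := Real.add_one_le_exp (-(1 - z i))
          linarith
      _ = Real.exp (-((1 - z i) * ⌊t / p i⌋₊)) := by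
          rw [← Real.exp_nat_mul]; ring_nf
      _ ≤ Real.exp (1 + -(q / 2) * t) := by
          refine Real.exp_le_exp.2 ?_
          have h3 : t / p i - 1 ≤ ⌊t / p i⌋₊ := by linarith [Nat.lt_floor_add_one (t / p i)]
          have h4 : (1 - z i) * (t / p i - 1) ≤ (1 - z i) * ⌊t / p i⌋₊ :=
            mul_le_mul_of_nonneg_left h3 hwi.le
          have h5 : q / 2 * t ≤ (1 - z i) / p i * t := mul_le_mul_of_nonneg_right h2.le ht'.le
          have h6 : (1 - z i) * (t / p i - 1) = (1 - z i) / p i * t - (1 - z i) := by ring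
          have := hwi1.2
          linarith
      _ = _ := Real.exp_add _ _
  · exact ((integrableOn_exp_mul_Ioi (by linarith) 0).const_mul _).const_mul _
  · refine (ae_restrict_mem measurableSet_Ioi).mono fun t ht => ?_
    refine hzp.mul (Tendsto.mul ?_ (hlim t ht _ (hfl1 t ht)))
    have h1 : Tendsto (fun i => (⌊t / p i⌋₊ : ℝ) * (1 - z i)) l (𝓝 (t * q)) := by
      refine ((hfl t ht).mul hzp).congr' ?_
      filter_upwards [hppos] with i hi
      field_simp
    simpa using tendsto_one_sub_pow hw h1

end

/-! ### The Laplace transform of the return time -/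

section

lemma sum_waitingTime {Ω : Type*} {T : ℕ → Ω → ℝ} (hT0 : ∀ ω, T 0 ω = 0) (n : ℕ) (ω : Ω) :
    ∑ i ∈ Finset.range n, waitingTime T i ω = T n ω := by
  simp only [waitingTime]
  rw [Finset.sum_range_sub (fun i => T i ω), hT0, sub_zero]

variable {Ω : Type*} [MeasurableSpace Ω] {μ : Measure Ω} {X W T : ℕ → Ω → ℝ}

lemma integral_exp_neg_sum (hW : ∀ n, Measurable (W n)) (hindep : iIndepFun W μ)
    (hident : ∀ n, IdentDistrib (W n) (W 0) μ μ) (r : ℝ) (n : ℕ) :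
    ∫ ω, Real.exp (-(r * ∑ i ∈ Finset.range n, W i ω)) ∂μ = laplace (μ.map (W 0)) r ^ n := by
  have h1 : ∀ i, mgf (W i) μ (-r) = laplace (μ.map (W 0)) r := by
    intro i
    have : mgf (W i) μ (-r) = mgf (W 0) μ (-r) :=
      ((hident i).comp (u := fun x => Real.exp (-r * x)) (by fun_prop)).integral_eq
    rw [this, laplace, integral_map (hW 0).aemeasurable (by fun_prop)]
    simp only [mgf, neg_mul]
  have h2 := hindep.mgf_sum hW (t := -r) (Finset.range n)
  simp only [h1, Finset.prod_const, Finset.card_range] at h2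
  rw [← h2, mgf]
  simp only [Finset.sum_apply, neg_mul]

lemma laplace_map_sum_div (hW : ∀ n, Measurable (W n)) (hindep : iIndepFun W μ)
    (hident : ∀ n, IdentDistrib (W n) (W 0) μ μ) (c s : ℝ) (n : ℕ) :
    laplace (μ.map fun ω => (∑ i ∈ Finset.range n, W i ω) / c) s =
      laplace (μ.map (W 0)) (s / c) ^ n := by
  rw [← integral_exp_neg_sum hW hindep hident, laplace, integral_map (by fun_prop) (by fun_prop)]
  refine integral_congr_ae (Eventually.of_forall fun ω => ?_)
  simp only
  congr 2
  ring

variable [IsProbabilityMeasure μ]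

/-- Conditioning on the first exceedance time: the `k`-th term carries `k + 1` independent waiting
times, which are independent of the magnitudes. -/
theorem hasSum_integral_exp_neg_returnTime (hX : ∀ n, Measurable (X n))
    (hT : ∀ n, Measurable (T n)) (hT0 : ∀ ω, T 0 ω = 0)
    (hW0 : ∀ n, ∀ᵐ ω ∂μ, 0 ≤ waitingTime T n ω)
    (hXW : IndepFun (fun ω n => X n ω) (fun ω n => waitingTime T n ω) μ)
    (hstat : IsStrictlyStationary X μ) (hindep : iIndepFun (waitingTime T) μ)
    (hident : ∀ n, IdentDistrib (waitingTime T n) (waitingTime T 0) μ μ) (u : ℝ) {r : ℝ}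
    (hr : 0 ≤ r) :
    HasSum (fun k => laplace (μ.map (waitingTime T 0)) r ^ (k + 1) *
        ((noExceedProb X μ u k - noExceedProb X μ u (k + 1)) -
          (noExceedProb X μ u (k + 1) - noExceedProb X μ u (k + 2))))
      (∫ ω in {ω | u < X 0 ω}, Real.exp (-(r * returnTime X T u ω)) ∂μ) := by
  have hWm : ∀ n, Measurable (waitingTime T n) := fun n => (hT (n + 1)).sub (hT n)
  have hTnn : ∀ᵐ ω ∂μ, ∀ n, 0 ≤ T n ω := by
    filter_upwards [ae_all_iff.2 hW0] with ω hω n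
    rw [← sum_waitingTime hT0]
    exact Finset.sum_nonneg fun i _ => hω i
  set D : ℕ → Set Ω := fun k => survivalSet X u k \ survivalSet X u (k + 1) with hD
  have hDmeas : ∀ k, MeasurableSet (D k) := fun k =>
    (measurableSet_survivalSet hX u k).diff (measurableSet_survivalSet hX u (k + 1))
  have hDτ : ∀ k ω, ω ∈ D k → firstExceedance X u ω = k + 1 := by
    rintro k ω ⟨h1, h2⟩
    refine firstExceedance_eq_succ_iff.2 ⟨h1.2, ?_⟩
    by_contra h
    refine h2 ⟨h1.1, fun i hi => ?_⟩
    rcases Nat.lt_succ_iff_lt_or_eq.1 hi with hi | rfl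
    · exact h1.2 i hi
    · exact not_lt.1 h
  have hDdisj : Pairwise (Function.onFun Disjoint D) := by
    intro j k hjk
    refine Set.disjoint_left.2 fun ω hj hk => hjk ?_
    have := (hDτ j ω hj).symm.trans (hDτ k ω hk)
    omega
  have hDunion : (⋃ k, D k) =ᵐ[μ] {ω | u < X 0 ω} := by
    have hsub : (⋃ k, D k) ⊆ {ω | u < X 0 ω} := Set.iUnion_subset fun k ω hω => hω.1.1
    refine (hsub.eventuallyLE).antisymm ?_
    filter_upwards [ae_exists_exceedance hX hstat u] with ω hω h0
    have h0' : u < X 0 ω := h0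
    have hne : {k : ℕ | 1 ≤ k ∧ u < X k ω}.Nonempty := hω h0'
    have hpos : 1 ≤ firstExceedance X u ω := (Nat.sInf_mem hne).1
    obtain ⟨k, hk⟩ := Nat.exists_eq_add_of_le' hpos
    have h := firstExceedance_eq_succ_iff.1 hk
    exact Set.mem_iUnion.2 ⟨k, ⟨h0', h.1⟩, fun h' => absurd h.2 (not_lt.2 (h'.2 k (by omega)))⟩
  have hint : Integrable (fun ω => Real.exp (-(r * returnTime X T u ω))) μ := by
    refine Integrable.of_bound (C := 1) ?_ ?_
    · have := measurable_returnTime hX hT u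
      exact Measurable.aestronglyMeasurable (by fun_prop)
    · filter_upwards [hTnn] with ω hω
      rw [Real.norm_eq_abs, abs_of_pos (Real.exp_pos _), Real.exp_le_one_iff]
      have := mul_nonneg hr (hω (firstExceedance X u ω))
      simp only [returnTime]
      linarith
  have hsum := hasSum_integral_iUnion hDmeas hDdisj (hint.integrableOn (s := ⋃ k, D k))
  rw [setIntegral_congr_set hDunion] at hsum
  refine hsum.congr_fun fun k => ?_
  -- the event `D k` is determined by the magnitudes
  set B : Set (ℕ → ℝ) := survivalSet (fun n x => x n) u k \ survivalSet (fun n x => x n) u (k + 1)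
    with hB
  have hBmeas : MeasurableSet B :=
    (measurableSet_survivalSet (fun n => measurable_pi_apply n) u k).diff
      (measurableSet_survivalSet (fun n => measurable_pi_apply n) u (k + 1))
  set φ : (ℕ → ℝ) → ℝ := B.indicator 1 with hφ
  have hφm : Measurable φ := measurable_one.indicator hBmeas
  set ψ : (ℕ → ℝ) → ℝ := fun w => Real.exp (-(r * ∑ i ∈ Finset.range (k + 1), w i)) with hψ
  have hψm : Measurable ψ := by fun_prop
  have hXm : Measurable fun ω n => X n ω := measurable_pi_lambda _ hX
  have hWm' : Measurable fun ω n => waitingTime T n ω := measurable_pi_lambda _ hWm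
  have hmul := (hXW.comp hφm hψm).integral_mul_eq_mul_integral
    (hφm.comp hXm).aestronglyMeasurable (hψm.comp hWm').aestronglyMeasurable
  have hφD : ∀ ω, φ (fun n => X n ω) = (D k).indicator 1 ω := fun ω => rfl
  have h1 : ∫ ω in D k, Real.exp (-(r * returnTime X T u ω)) ∂μ =
      ∫ ω, ((φ ∘ fun ω n => X n ω) * (ψ ∘ fun ω n => waitingTime T n ω)) ω ∂μ := by
    rw [← integral_indicator (hDmeas k)]
    refine integral_congr_ae (Eventually.of_forall fun ω => ?_)
    simp only [Pi.mul_apply, Function.comp, hφD]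
    by_cases hω : ω ∈ D k
    · simp only [Set.indicator_of_mem hω, Pi.one_apply, one_mul, hψ]
      rw [sum_waitingTime hT0, returnTime, hDτ k ω hω]
    · simp [Set.indicator_of_notMem hω]
  have h2 : ∫ ω, (φ ∘ fun ω n => X n ω) ω ∂μ = μ.real (D k) := by
    simp only [Function.comp, hφD]
    exact integral_indicator_one (hDmeas k)
  have h3 : ∫ ω, (ψ ∘ fun ω n => waitingTime T n ω) ω ∂μ =
      laplace (μ.map (waitingTime T 0)) r ^ (k + 1) :=
    integral_exp_neg_sum hWm hindep hident r (k + 1)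
  have h4 : μ.real (D k) = (noExceedProb X μ u k - noExceedProb X μ u (k + 1)) -
      (noExceedProb X μ u (k + 1) - noExceedProb X μ u (k + 2)) := by
    rw [hD, measureReal_sdiff (survivalSet_succ_subset u k)
      (measurableSet_survivalSet hX u (k + 1)), real_survivalSet hX hstat, real_survivalSet hX hstat]
  rw [h1, hmul, h2, h3, h4, mul_comm]

lemma noExceedProb_one (hX : ∀ n, Measurable (X n)) (hstat : IsStrictlyStationary X μ) (u : ℝ) :
    1 - noExceedProb X μ u 1 = exceedProb X μ u := by
  have h := real_survivalSet hX hstat u 0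
  rw [noExceedProb_zero] at h
  rw [← h, exceedProb]
  congr 1
  ext ω
  simp [survivalSet]

/-- The Laplace transform of the conditional law of the return time, in terms of the Laplace
transform `z` of a single waiting time. -/
theorem laplace_scaledReturnLaw (hX : ∀ n, Measurable (X n))
    (hT : ∀ n, Measurable (T n)) (hT0 : ∀ ω, T 0 ω = 0)
    (hW0 : ∀ n, ∀ᵐ ω ∂μ, 0 ≤ waitingTime T n ω)
    (hXW : IndepFun (fun ω n => X n ω) (fun ω n => waitingTime T n ω) μ)
    (hstat : IsStrictlyStationary X μ) (hindep : iIndepFun (waitingTime T) μ)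
    (hident : ∀ n, IdentDistrib (waitingTime T n) (waitingTime T 0) μ μ) {u : ℝ}
    (hu : 0 < exceedProb X μ u) {s c : ℝ} (hs : 0 ≤ s) (hc : 0 < c) {z : ℝ}
    (hz : laplace (μ.map (waitingTime T 0)) (s / c) = z) (hz1 : z < 1) :
    laplace (scaledReturnLaw X T μ u c : Measure ℝ) s =
      1 - (1 - z) / exceedProb X μ u *
        (1 - (1 - z) * ∑' k, z ^ k * noExceedProb X μ u (k + 1)) := by
  have hr : 0 ≤ s / c := by positivity
  have hz0 : 0 ≤ z := hz ▸ laplace_nonneg _ _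
  have h1 := hasSum_integral_exp_neg_returnTime hX hT hT0 hW0 hXW hstat hindep hident u hr
  rw [hz] at h1
  have h2 := hasSum_generating (noExceedProb_zero (X := X) (μ := μ) u) (noExceedProb_nonneg u)
    (noExceedProb_le_one u) hz0 hz1
  rw [noExceedProb_one hX hstat] at h2
  have h3 := h1.unique h2
  have hRm : Measurable fun ω => returnTime X T u ω / c :=
    (measurable_returnTime hX hT u).div_const c
  have h4 : laplace (scaledReturnLaw X T μ u c : Measure ℝ) s = (exceedProb X μ u)⁻¹ *
      ∫ ω in {ω | u < X 0 ω}, Real.exp (-(s / c * returnTime X T u ω)) ∂μ := by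
    change ∫ x, Real.exp (-(s * x)) ∂((μ[|{ω | u < X 0 ω}]).map
      fun ω => returnTime X T u ω / c) = _
    rw [integral_map hRm.aemeasurable (by fun_prop), ProbabilityTheory.cond, integral_smul_measure,
      ENNReal.toReal_inv, smul_eq_mul]
    congr 1
    refine integral_congr_ae (Eventually.of_forall fun ω => ?_)
    simp only
    congr 2
    ring
  rw [h4, h3]
  field_simp

lemma scaledReturnLaw_Iio (hX : ∀ n, Measurable (X n)) (hT : ∀ n, Measurable (T n))
    (hT0 : ∀ ω, T 0 ω = 0) (hW0 : ∀ n, ∀ᵐ ω ∂μ, 0 ≤ waitingTime T n ω) (u : ℝ) {c : ℝ}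
    (hc : 0 < c) : (scaledReturnLaw X T μ u c : Measure ℝ) (Set.Iio 0) = 0 := by
  have hRm : Measurable fun ω => returnTime X T u ω / c :=
    (measurable_returnTime hX hT u).div_const c
  have hTnn : ∀ᵐ ω ∂μ, ∀ n, 0 ≤ T n ω := by
    filter_upwards [ae_all_iff.2 hW0] with ω hω n
    rw [← sum_waitingTime hT0]
    exact Finset.sum_nonneg fun i _ => hω i
  refine measure_Iio_of_ae_nonneg ?_
  change ∀ᵐ x ∂((μ[|{ω | u < X 0 ω}]).map fun ω => returnTime X T u ω / c), 0 ≤ x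
  rw [ae_map_iff hRm.aemeasurable measurableSet_Ici]
  refine (cond_absolutelyContinuous (μ := μ)).ae_le ?_
  filter_upwards [hTnn] with ω hω
  exact div_nonneg (hω _) hc.le

lemma isProbabilityMeasure_scaledReturnLaw (hX : ∀ n, Measurable (X n))
    (hT : ∀ n, Measurable (T n)) {u : ℝ} (hu : 0 < exceedProb X μ u) (c : ℝ) :
    IsProbabilityMeasure (scaledReturnLaw X T μ u c : Measure ℝ) := by
  have : IsProbabilityMeasure (μ[|{ω | u < X 0 ω}]) :=
    cond_isProbabilityMeasure (ENNReal.toReal_pos_iff.1 hu).1.ne'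
  exact Measure.isProbabilityMeasure_map
    ((measurable_returnTime hX hT u).div_const c).aemeasurable

end

/-! ### Norming functions of the waiting times -/

section

variable {Ω : Type*} [MeasurableSpace Ω] {μ : Measure Ω} {W : ℕ → Ω → ℝ}

lemma regularlyVarying_tail_map (hW : Measurable (W 0)) {ρ : ℝ}
    (h : RegularlyVarying (fun x => μ.real {ω | x < W 0 ω}) ρ) :
    RegularlyVarying (fun x => (μ.map (W 0)).real (Set.Ioi x)) ρ := by
  have : (fun x => (μ.map (W 0)).real (Set.Ioi x)) = fun x => μ.real {ω | x < W 0 ω} := by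
    ext x
    rw [map_measureReal_apply hW measurableSet_Ioi]
    rfl
  rwa [this]

lemma map_Iio_eq_zero {f : Ω → ℝ} (hf : Measurable f) (h : ∀ᵐ ω ∂μ, 0 ≤ f ω) :
    (μ.map f) (Set.Iio 0) = 0 :=
  measure_Iio_of_ae_nonneg ((ae_map_iff hf.aemeasurable measurableSet_Ici).2 h)

lemma tendsto_mul_one_sub_of_tendsto_pow {y : ℕ → ℝ} {c : ℝ} (hc : 0 < c)
    (h : Tendsto (fun n => y n ^ n) atTop (𝓝 (Real.exp (-c)))) (hy : ∀ n, 0 ≤ y n) :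
    Tendsto (fun n : ℕ => (n : ℝ) * (1 - y n)) atTop (𝓝 c) := by
  have hlog : Tendsto (fun n : ℕ => (n : ℝ) * Real.log (y n)) atTop (𝓝 (-c)) := by
    have := h.log (Real.exp_pos _).ne'
    rw [Real.log_exp] at this
    refine this.congr fun n => ?_
    rw [Real.log_pow]
  have hypos : ∀ᶠ n in atTop, 0 < y n := by
    filter_upwards [h.eventually_const_lt (Real.exp_pos _), eventually_ne_atTop 0] with n hn hn0
    refine lt_of_le_of_ne (hy n) fun h0 => ?_
    rw [← h0, zero_pow hn0] at hn
    exact lt_irrefl _ hn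
  have hneg : ∀ᶠ n in atTop, Real.log (y n) < 0 := by
    filter_upwards [hlog.eventually_lt_const (show -c < 0 by linarith)] with n hn
    by_contra hcon
    exact absurd hn (not_lt.2 (mul_nonneg (Nat.cast_nonneg n) (not_lt.1 hcon)))
  have hlog0 : Tendsto (fun n => Real.log (y n)) atTop (𝓝[≠] 0) := by
    refine tendsto_nhdsWithin_iff.2 ⟨?_, hneg.mono fun n hn => hn.ne⟩
    have := hlog.mul (tendsto_inv_atTop_nhds_zero_nat (𝕜 := ℝ))
    rw [mul_zero] at this
    refine this.congr' ?_
    filter_upwards [eventually_ne_atTop 0] with n hn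
    have : (n : ℝ) ≠ 0 := by exact_mod_cast hn
    field_simp
  have hslope := (Real.hasDerivAt_exp 0).tendsto_slope_zero.comp hlog0
  have h2 := (hlog.mul hslope).neg
  rw [Real.exp_zero, mul_one, neg_neg] at h2
  refine h2.congr' ?_
  filter_upwards [hypos, hneg] with n hn hn'
  simp only [Function.comp, zero_add, Real.exp_log hn, smul_eq_mul]
  have := hn'.ne
  field_simp
  ring

variable [IsProbabilityMeasure μ]

theorem exists_isStableNorming (hW : ∀ n, Measurable (W n)) (hW0 : ∀ n, ∀ᵐ ω ∂μ, 0 ≤ W n ω)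
    (hindep : iIndepFun W μ) (hident : ∀ n, IdentDistrib (W n) (W 0) μ μ) {α : ℝ} (hα0 : 0 < α)
    (hα1 : α < 1) (htail : RegularlyVarying (fun x => μ.real {ω | x < W 0 ω}) (-α)) :
    ∃ b : ℝ → ℝ, IsStableNorming W μ α b := by
  have : IsProbabilityMeasure (μ.map (W 0)) := Measure.isProbabilityMeasure_map (hW 0).aemeasurable
  have h0 := map_Iio_eq_zero (hW 0) (hW0 0)
  have hκ := regularlyVarying_tail_map (hW 0) htail
  have hpos : 0 < (μ.map (W 0)).real (Set.Ioi 0) :=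
    (hκ.pos 1 one_pos).trans_le (antitone_tail _ zero_le_one)
  obtain ⟨b, hb, hlim⟩ := exists_regularlyVarying_norming h0 hα0 hα1 hκ
  refine ⟨b, hb, ?_⟩
  have hSm : ∀ n : ℕ, Measurable fun ω => (∑ i ∈ Finset.range n, W i ω) / b n := fun n => by
    fun_prop
  let ν : ℕ → ProbabilityMeasure ℝ := fun n =>
    ⟨μ.map fun ω => (∑ i ∈ Finset.range n, W i ω) / b n,
      Measure.isProbabilityMeasure_map (hSm n).aemeasurable⟩
  have hν0 : ∀ n, (ν n : Measure ℝ) (Set.Iio 0) = 0 := by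
    intro n
    refine map_Iio_eq_zero (hSm n) ?_
    filter_upwards [ae_all_iff.2 hW0] with ω hω
    rcases Nat.eq_zero_or_pos n with rfl | hn
    · simp
    · exact div_nonneg (Finset.sum_nonneg fun i _ => hω i) (hb.pos _ (by exact_mod_cast hn)).le
  have hνL : ∀ s, 0 < s → Tendsto (fun n => laplace (ν n) s) atTop
      (𝓝 (Real.exp (-s ^ α))) := by
    intro s hs
    have hsα : 0 < s ^ α := by positivity
    have hψ0 : Tendsto (fun n : ℕ => laplaceDefect (μ.map (W 0)) (s / b n)) atTop (𝓝[>] 0) := by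
      refine tendsto_nhdsWithin_iff.2 ⟨?_, ?_⟩
      · have := (hlim s hs).mul (tendsto_inv_atTop_nhds_zero_nat (𝕜 := ℝ))
        rw [mul_zero] at this
        refine this.congr' ?_
        filter_upwards [eventually_ne_atTop 0] with n hn
        have : (n : ℝ) ≠ 0 := by exact_mod_cast hn
        field_simp
      · filter_upwards [(hlim s hs).eventually_const_lt hsα] with n hn
        exact pos_of_mul_pos_right hn (Nat.cast_nonneg n)
    have h1 := tendsto_one_sub_pow (N := fun n => n) hψ0 (hlim s hs)
    refine h1.congr fun n => ?_
    have : laplace (ν n) s = laplace (μ.map (W 0)) (s / b n) ^ n :=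
      laplace_map_sum_div hW hindep hident (b n) s n
    rw [this, laplaceDefect, sub_sub_cancel]
  have hL1 : Tendsto (fun s : ℝ => Real.exp (-s ^ α)) (𝓝[>] 0) (𝓝 1) := by
    have h1 : Continuous fun s : ℝ => Real.exp (-s ^ α) := by
      have := Real.continuous_rpow_const hα0.le
      fun_prop
    have h2 := h1.tendsto 0
    rw [Real.zero_rpow hα0.ne', neg_zero, Real.exp_zero] at h2
    exact h2.mono_left nhdsWithin_le_nhds
  obtain ⟨D, hD0, hDL, hνD⟩ := exists_tendsto_of_tendsto_laplace hν0 hνL hL1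
  refine ⟨D, ⟨hD0, fun s hs => ?_⟩, ⟨fun n => (hSm n).aemeasurable, aemeasurable_id, ?_⟩⟩
  · rcases hs.eq_or_lt with rfl | hs
    · simp [Real.zero_rpow hα0.ne']
    · exact hDL s hs
  · have hid : (⟨(D : Measure ℝ).map id, Measure.isProbabilityMeasure_map aemeasurable_id⟩ :
        ProbabilityMeasure ℝ) = D := Subtype.ext Measure.map_id
    rw [hid]
    exact hνD

/-- For every norming function the convergence in law, which concerns the integers only, determines
the behaviour of the Laplace transform at all large real arguments. -/
theorem IsStableNorming.tendsto_mul_laplaceDefect (hW : ∀ n, Measurable (W n))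
    (hW0 : ∀ n, ∀ᵐ ω ∂μ, 0 ≤ W n ω) (hindep : iIndepFun W μ)
    (hident : ∀ n, IdentDistrib (W n) (W 0) μ μ) {α : ℝ}
    (htail : RegularlyVarying (fun x => μ.real {ω | x < W 0 ω}) (-α)) {b : ℝ → ℝ}
    (hb : IsStableNorming W μ α b) {s : ℝ} (hs : 0 < s) :
    Tendsto (fun x => x * laplaceDefect (μ.map (W 0)) (s / b x)) atTop (𝓝 (s ^ α)) := by
  have : IsProbabilityMeasure (μ.map (W 0)) := Measure.isProbabilityMeasure_map (hW 0).aemeasurable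
  have h0 := map_Iio_eq_zero (hW 0) (hW0 0)
  have hκ := regularlyVarying_tail_map (hW 0) htail
  have hpos : 0 < (μ.map (W 0)).real (Set.Ioi 0) :=
    (hκ.pos 1 one_pos).trans_le (antitone_tail _ zero_le_one)
  obtain ⟨hbrv, D, hD, hlim⟩ := hb
  refine hbrv.tendsto_mul_laplaceDefect h0 hpos (fun r hr => ?_) hs
  have hν0 : ∀ n : ℕ, (μ.map fun ω => (∑ i ∈ Finset.range n, W i ω) / b n) (Set.Iio 0) = 0 := by
    intro n
    refine map_Iio_eq_zero (by fun_prop) ?_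
    filter_upwards [ae_all_iff.2 hW0] with ω hω
    rcases Nat.eq_zero_or_pos n with rfl | hn
    · simp
    · exact div_nonneg (Finset.sum_nonneg fun i _ => hω i)
        (hbrv.pos _ (by exact_mod_cast hn)).le
  have h1 := tendsto_laplace_of_tendsto hlim.tendsto hν0 hr.le
  have h2 : laplace ((D : Measure ℝ).map id) r = Real.exp (-r ^ α) := by
    rw [Measure.map_id]
    exact hD.2 r hr.le
  have h3 : Tendsto (fun n : ℕ => laplace (μ.map (W 0)) (r / b n) ^ n) atTop
      (𝓝 (Real.exp (-r ^ α))) := by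
    rw [← h2]
    exact h1.congr fun n => laplace_map_sum_div hW hindep hident (b n) r n
  exact tendsto_mul_one_sub_of_tendsto_pow (by positivity) h3 fun n => laplace_nonneg _ _

/-! ### Mittag-Leffler laws and the limiting mixture -/

/-- The Mittag-Leffler law is the law of `E ^ (1/α) * D`, with `D` one-sided stable and `E`
standard exponential, here realized as `-log U` with `U` uniform on `(0,1)`. -/
theorem exists_isMittagLeffler {α σ : ℝ} (hα0 : 0 < α) {D : ProbabilityMeasure ℝ}
    (hD : IsOneSidedStable α D) : ∃ Q : ProbabilityMeasure ℝ, IsMittagLeffler α σ Q := by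
  set U : Measure ℝ := volume.restrict (Set.Ioc 0 1) with hU
  have hUp : IsProbabilityMeasure U := ⟨by simp [hU]⟩
  set f : ℝ × ℝ → ℝ := fun y => (-Real.log y.1) ^ (1 / α) * y.2 with hf
  have hfm : Measurable f := by fun_prop
  set R : Measure ℝ := (U.prod (D : Measure ℝ)).map f with hR
  have hRp : IsProbabilityMeasure R := Measure.isProbabilityMeasure_map hfm.aemeasurable
  have hlog : ∀ᵐ u ∂U, 0 < u ∧ 0 ≤ -Real.log u := by
    filter_upwards [ae_restrict_mem measurableSet_Ioc] with u hu
    exact ⟨hu.1, neg_nonneg.2 (Real.log_nonpos hu.1.le hu.2)⟩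
  have hfnn : ∀ᵐ y ∂(U.prod (D : Measure ℝ)), 0 ≤ f y := by
    filter_upwards [Measure.quasiMeasurePreserving_fst.ae hlog,
      Measure.quasiMeasurePreserving_snd.ae (ae_nonneg_of_measure_Iio hD.1)] with y hy1 hy2
    exact mul_nonneg (Real.rpow_nonneg hy1.2 _) hy2
  have hR0 : R (Set.Iio 0) = 0 := map_Iio_eq_zero hfm hfnn
  have hRL : ∀ s : ℝ, 0 ≤ s → laplace R s = 1 / (1 + s ^ α) := by
    intro s hs
    have hsα : 0 ≤ s ^ α := by positivity
    have hint : Integrable (fun y => Real.exp (-(s * f y))) (U.prod (D : Measure ℝ)) := by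
      refine Integrable.of_bound (C := 1) (Measurable.aestronglyMeasurable (by fun_prop)) ?_
      filter_upwards [hfnn] with y hy
      rw [Real.norm_eq_abs, abs_of_pos (Real.exp_pos _), Real.exp_le_one_iff]
      have := mul_nonneg hs hy
      linarith
    rw [laplace, integral_map hfm.aemeasurable (by fun_prop), integral_prod _ hint]
    have h1 : ∫ u, ∫ x, Real.exp (-(s * f (u, x))) ∂(D : Measure ℝ) ∂U = ∫ u, u ^ (s ^ α) ∂U := by
      refine integral_congr_ae ?_
      filter_upwards [hlog] with u hu
      have h2 := hD.2 (s * (-Real.log u) ^ (1 / α))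
        (mul_nonneg hs (Real.rpow_nonneg hu.2 _))
      simp only [hf, ← mul_assoc]
      rw [h2, Real.mul_rpow hs (Real.rpow_nonneg hu.2 _), ← Real.rpow_mul hu.2,
        one_div_mul_cancel hα0.ne', Real.rpow_one, Real.rpow_def_of_pos hu.1]
      ring_nf
    rw [h1, hU, ← intervalIntegral.integral_of_le zero_le_one,
      integral_rpow (Or.inl (by linarith))]
    rw [Real.one_rpow, Real.zero_rpow (by positivity), sub_zero, add_comm]
  have hRpos : R (Set.Iic 0) = 0 := by
    -- an atom at `0` would keep the Laplace transform away from `0` at infinity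
    have hle : ∀ s : ℝ, 0 ≤ s → R.real (Set.Iic 0) ≤ 1 / (1 + s ^ α) := by
      intro s hs
      rw [← hRL s hs, ← integral_indicator_one measurableSet_Iic]
      refine integral_mono_of_nonneg (Eventually.of_forall fun x =>
        Set.indicator_nonneg (fun _ _ => zero_le_one) x) (integrable_exp_neg hR0 hs)
        (Eventually.of_forall fun x => ?_)
      by_cases hx : x ∈ Set.Iic (0 : ℝ)
      · rw [Set.indicator_of_mem hx]
        have hx' : x ≤ 0 := hx
        have : s * x ≤ 0 := mul_nonpos_of_nonneg_of_nonpos hs hx'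
        exact Real.one_le_exp (by linarith)
      · rw [Set.indicator_of_notMem hx]
        exact (Real.exp_pos _).le
    have hlim : Tendsto (fun s : ℝ => 1 / (1 + s ^ α)) atTop (𝓝 0) := by
      simp_rw [one_div]
      exact tendsto_inv_atTop_zero.comp
        (tendsto_atTop_add_const_left _ 1 (tendsto_rpow_atTop hα0))
    have := ge_of_tendsto hlim ((eventually_ge_atTop 0).mono hle)
    exact (measureReal_eq_zero_iff).1 (le_antisymm this measureReal_nonneg)
  exact ⟨⟨R.map fun y => σ * y, Measure.isProbabilityMeasure_map (by fun_prop)⟩,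
    ⟨R, hRp⟩, hRpos, hRL, rfl⟩

lemma IsMittagLeffler.measure_Iio {α σ : ℝ} (hσ : 0 ≤ σ) {Q : ProbabilityMeasure ℝ}
    (hQ : IsMittagLeffler α σ Q) : (Q : Measure ℝ) (Set.Iio 0) = 0 := by
  obtain ⟨R, hR0, -, hQR⟩ := hQ
  rw [hQR]
  refine map_Iio_eq_zero (by fun_prop) ?_
  filter_upwards [ae_nonneg_of_measure_Iio (measure_mono_null Set.Iio_subset_Iic_self hR0)]
    with x hx using mul_nonneg hσ hx

lemma IsMittagLeffler.laplace_eq {α σ : ℝ} (hσ : 0 ≤ σ) {Q : ProbabilityMeasure ℝ}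
    (hQ : IsMittagLeffler α σ Q) {s : ℝ} (hs : 0 ≤ s) :
    laplace (Q : Measure ℝ) s = 1 / (1 + (σ * s) ^ α) := by
  obtain ⟨R, -, hRL, hQR⟩ := hQ
  rw [hQR, laplace, integral_map (by fun_prop) (by fun_prop), ← hRL _ (mul_nonneg hσ hs)]
  refine integral_congr_ae (Eventually.of_forall fun x => ?_)
  simp only
  congr 2
  ring

lemma laplace_zeroMixture {θ : ℝ} (hθ0 : 0 ≤ θ) (hθ1 : θ ≤ 1) {Q : ProbabilityMeasure ℝ}
    (hQ : (Q : Measure ℝ) (Set.Iio 0) = 0) {s : ℝ} (hs : 0 ≤ s) :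
    laplace (zeroMixture θ Q : Measure ℝ) s = (1 - θ) + θ * laplace (Q : Measure ℝ) s := by
  have h1 : Integrable (fun x => Real.exp (-(s * x))) (Q : Measure ℝ) := integrable_exp_neg hQ hs
  change ∫ x, Real.exp (-(s * x)) ∂((1 - θ).toNNReal • Measure.dirac (0 : ℝ) +
    θ.toNNReal • (Q : Measure ℝ)) = _
  have h2 : Integrable (fun x => Real.exp (-(s * x))) (Measure.dirac (0 : ℝ)) :=
    integrable_dirac (by finiteness)
  rw [integral_add_measure (h2.smul_measure_nnreal) (h1.smul_measure_nnreal),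
    integral_smul_nnreal_measure, integral_smul_nnreal_measure, integral_dirac]
  simp only [NNReal.smul_def, smul_eq_mul, mul_zero, neg_zero, Real.exp_zero, mul_one]
  rw [Real.coe_toNNReal _ hθ0, Real.coe_toNNReal _ (by linarith)]
  rfl

lemma zeroMixture_Iio {θ : ℝ} {Q : ProbabilityMeasure ℝ} (hQ : (Q : Measure ℝ) (Set.Iio 0) = 0) :
    (zeroMixture θ Q : Measure ℝ) (Set.Iio 0) = 0 := by
  change ((1 - θ).toNNReal • Measure.dirac (0 : ℝ) + θ.toNNReal • (Q : Measure ℝ))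
    (Set.Iio 0) = 0
  simp [hQ]

lemma isProbabilityMeasure_zeroMixture {θ : ℝ} (hθ0 : 0 ≤ θ) (hθ1 : θ ≤ 1)
    (Q : ProbabilityMeasure ℝ) : IsProbabilityMeasure (zeroMixture θ Q : Measure ℝ) := by
  refine ⟨?_⟩
  change ((1 - θ).toNNReal • Measure.dirac (0 : ℝ) + θ.toNNReal • (Q : Measure ℝ)) Set.univ = 1
  simp only [Measure.coe_add, Measure.coe_nnreal_smul_apply, Pi.add_apply, measure_univ, mul_one]
  rw [← ENNReal.coe_add, ← Real.toNNReal_add (by linarith) hθ0]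
  simp

/-! ### Weak convergence of the return times -/

/-- The Laplace transforms of the conditional laws of `T(u) / b (1 / p u)` converge to
`1 - q (1 - q / (q + θ))` with `q = s ^ α`, which is the Laplace transform of the mixture. -/
theorem tendsto_scaledReturnLaw {X T : ℕ → Ω → ℝ} (hX : ∀ n, Measurable (X n))
    (hT : ∀ n, Measurable (T n)) (hT0 : ∀ ω, T 0 ω = 0)
    (hW0 : ∀ n, ∀ᵐ ω ∂μ, 0 ≤ waitingTime T n ω)
    (hXW : IndepFun (fun ω n => X n ω) (fun ω n => waitingTime T n ω) μ)
    (hstat : IsStrictlyStationary X μ) {θ : ℝ} (hθ0 : 0 < θ) (hθ1 : θ ≤ 1)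
    (hθ : HasExtremalIndex X μ θ) (hWindep : iIndepFun (waitingTime T) μ)
    (hWident : ∀ n, IdentDistrib (waitingTime T n) (waitingTime T 0) μ μ) {α : ℝ} (hα0 : 0 < α)
    (hWtail : RegularlyVarying (fun x => μ.real {ω | x < waitingTime T 0 ω}) (-α))
    {Q : ProbabilityMeasure ℝ} (hQ : IsMittagLeffler α (θ ^ (-1 / α)) Q) {b : ℝ → ℝ}
    (hb : IsStableNorming (waitingTime T) μ α b) :
    Tendsto (fun u : ℝ => scaledReturnLaw X T μ u (b (1 / exceedProb X μ u)))
      (leftLimit (rightEndpoint X μ)) (𝓝 (zeroMixture θ Q)) := by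
  have hWm : ∀ n, Measurable (waitingTime T n) := fun n => (hT (n + 1)).sub (hT n)
  have hσ : 0 ≤ θ ^ (-1 / α) := by positivity
  have hQ0 := hQ.measure_Iio hσ
  have hMp := isProbabilityMeasure_zeroMixture hθ0.le hθ1 Q
  have hM0 := zeroMixture_Iio (θ := θ) hQ0
  have hWp : IsProbabilityMeasure (μ.map (waitingTime T 0)) :=
    Measure.isProbabilityMeasure_map (hWm 0).aemeasurable
  have : (leftLimit (rightEndpoint X μ)).IsCountablyGenerated := by
    unfold leftLimit; infer_instance
  refine tendsto_of_seq_tendsto fun u hu => ?_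
  have hp : Tendsto (fun n => exceedProb X μ (u n)) atTop (𝓝[>] 0) :=
    (tendsto_exceedProb (hX 0) hθ).comp hu
  have hppos : ∀ᶠ n in atTop, 0 < exceedProb X μ (u n) := hp.eventually self_mem_nhdsWithin
  have hinv : Tendsto (fun n => 1 / exceedProb X μ (u n)) atTop atTop := by
    simp_rw [one_div]
    exact tendsto_inv_nhdsGT_zero.comp hp
  have hcpos : ∀ n, 0 < exceedProb X μ (u n) → 0 < b (1 / exceedProb X μ (u n)) := fun n hn =>
    hb.1.pos _ (by positivity)
  -- only finitely many of the levels `u n` have `P (X 0 > u n) = 0`, and any law serves for these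
  let ν : ℕ → ProbabilityMeasure ℝ := fun n =>
    if h : 0 < exceedProb X μ (u n) then
      ⟨scaledReturnLaw X T μ (u n) (b (1 / exceedProb X μ (u n))),
        isProbabilityMeasure_scaledReturnLaw hX hT h _⟩
    else Q
  let M : ProbabilityMeasure ℝ := ⟨zeroMixture θ Q, hMp⟩
  have hν : ∀ n, 0 < exceedProb X μ (u n) →
      (ν n : Measure ℝ) = scaledReturnLaw X T μ (u n) (b (1 / exceedProb X μ (u n))) := by
    intro n hn
    have : ν n = ⟨scaledReturnLaw X T μ (u n) (b (1 / exceedProb X μ (u n))),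
        isProbabilityMeasure_scaledReturnLaw hX hT hn _⟩ := dif_pos hn
    rw [this]
    rfl
  have hν0 : ∀ n, (ν n : Measure ℝ) (Set.Iio 0) = 0 := by
    intro n
    by_cases hn : 0 < exceedProb X μ (u n)
    · rw [hν n hn]
      exact scaledReturnLaw_Iio hX hT hT0 hW0 _ (hcpos n hn)
    · have : ν n = Q := dif_neg hn
      rw [this]
      exact hQ0
  have key : Tendsto ν atTop (𝓝 M) := by
    refine tendsto_of_tendsto_laplace hν0 hM0 fun s hs => ?_
    set z : ℕ → ℝ := fun n =>
      laplace (μ.map (waitingTime T 0)) (s / b (1 / exceedProb X μ (u n))) with hz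
    set q := s ^ α with hq
    have hq0 : 0 < q := by positivity
    have hzp : Tendsto (fun n => (1 - z n) / exceedProb X μ (u n)) atTop (𝓝 q) := by
      refine ((hb.tendsto_mul_laplaceDefect hWm hW0 hWindep hWident hWtail hs).comp hinv).congr
        fun n => ?_
      simp only [Function.comp, laplaceDefect, hz]
      rw [one_div_mul_eq_div]
    have habel := tendsto_abel_mean (g := fun n => noExceedProb X μ (u n)) (θ := θ)
      (fun n k => noExceedProb_nonneg _ _) (fun n k => noExceedProb_le_one _ _) hq0 hθ0 hp
      (fun n => laplace_nonneg _ _) hzp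
      fun t ht N hN => tendsto_noExceedProb (hX 0) hθ0 hθ ht hp hN
    have hlim := (tendsto_const_nhds (x := (1 : ℝ))).sub
      (hzp.mul ((tendsto_const_nhds (x := (1 : ℝ))).sub habel))
    have hval : laplace (M : Measure ℝ) s = 1 - q * (1 - q / (q + θ)) := by
      have h1 : laplace (M : Measure ℝ) s = (1 - θ) + θ * laplace (Q : Measure ℝ) s :=
        laplace_zeroMixture hθ0.le hθ1 hQ0 hs.le
      have h2 : (θ ^ (-1 / α) * s) ^ α = q / θ := by
        rw [Real.mul_rpow hσ hs.le, ← Real.rpow_mul hθ0.le, div_mul_cancel₀ _ hα0.ne',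
          Real.rpow_neg_one, ← hq, div_eq_inv_mul]
      rw [h1, hQ.laplace_eq hσ hs.le, h2]
      have h3 : q + θ ≠ 0 := by positivity
      have h4 : 1 + q / θ ≠ 0 := by positivity
      have h5 : θ ≠ 0 := hθ0.ne'
      field_simp
      ring
    rw [hval]
    refine hlim.congr' ?_
    filter_upwards [hppos, hzp.eventually_const_lt hq0] with n hn hzn
    have hz1 : z n < 1 := by
      have := (div_pos_iff_of_pos_right hn).1 hzn
      linarith
    rw [hν n hn, laplace_scaledReturnLaw hX hT hT0 hW0 hXW hstat hWindep hWident hn hs.le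
      (hcpos n hn) rfl hz1]
  refine (ProbabilityMeasure.tendsto_nhds_iff_toFiniteMeasure_tendsto_nhds atTop).1 key
    |>.congr' ?_
  filter_upwards [hppos] with n hn
  exact Subtype.ext (hν n hn)

end

end ReturnTimes

theorem theorem2 {Ω : Type*} [MeasurableSpace Ω] (μ : Measure Ω) [IsProbabilityMeasure μ]
    -- event magnitudes `X n` and occurrence times `T n`, with nonnegative waiting times
    (X T : ℕ → Ω → ℝ) (hX : ∀ n, Measurable (X n)) (hT : ∀ n, Measurable (T n))
    (hT0 : ∀ ω, T 0 ω = 0) (hW0 : ∀ n, ∀ᵐ ω ∂μ, 0 ≤ ReturnTimes.waitingTime T n ω)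
    -- magnitudes and waiting times are independent of each other
    (hXW : IndepFun (fun ω n => X n ω) (fun ω n => ReturnTimes.waitingTime T n ω) μ)
    -- stationary magnitudes with extremal index `θ`
    (hstat : ReturnTimes.IsStrictlyStationary X μ)
    (θ : ℝ) (hθ0 : 0 < θ) (hθ1 : θ ≤ 1) (hθ : ReturnTimes.HasExtremalIndex X μ θ)
    -- i.i.d. waiting times with regularly varying tail
    (hWindep : iIndepFun (ReturnTimes.waitingTime T) μ)
    (hWident : ∀ n, IdentDistrib (ReturnTimes.waitingTime T n) (ReturnTimes.waitingTime T 0) μ μ)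
    (α : ℝ) (hα0 : 0 < α) (hα1 : α < 1)
    (hWtail : ReturnTimes.RegularlyVarying
      (fun x => μ.real {ω | x < ReturnTimes.waitingTime T 0 ω}) (-α)) :
    -- given `X 0 > u`, the return time is almost surely finite
    (∀ u : ℝ, ∀ᵐ ω ∂μ[|{ω | u < X 0 ω}], ∃ k : ℕ, 1 ≤ k ∧ u < X k ω) ∧
    -- the norming function exists
    (∃ b : ℝ → ℝ, ReturnTimes.IsStableNorming (ReturnTimes.waitingTime T) μ α b) ∧
    -- weak convergence of the conditional law of `T(u) / b (1 / p u)`, given `X 0 > u`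
    ∃ Q : ProbabilityMeasure ℝ, ReturnTimes.IsMittagLeffler α (θ ^ (-1 / α)) Q ∧
      ∀ b : ℝ → ℝ, ReturnTimes.IsStableNorming (ReturnTimes.waitingTime T) μ α b →
        Tendsto
          (fun u : ℝ => ReturnTimes.scaledReturnLaw X T μ u
            (b (1 / ReturnTimes.exceedProb X μ u)))
          (ReturnTimes.leftLimit (ReturnTimes.rightEndpoint X μ))
          (𝓝 (ReturnTimes.zeroMixture θ Q)) := by
  have hWm : ∀ n, Measurable (ReturnTimes.waitingTime T n) := fun n => (hT (n + 1)).sub (hT n)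
  obtain ⟨b, hb⟩ :=
    ReturnTimes.exists_isStableNorming hWm hW0 hWindep hWident hα0 hα1 hWtail
  refine ⟨fun u => ?_, ⟨b, hb⟩, ?_⟩
  · filter_upwards [ae_cond_mem (measurableSet_lt measurable_const (hX 0)),
      cond_absolutelyContinuous.ae_le (ReturnTimes.ae_exists_exceedance hX hstat u)] with ω h1 h2
    exact h2 h1
  · obtain ⟨-, D, hD, -⟩ := hb
    obtain ⟨Q, hQ⟩ := ReturnTimes.exists_isMittagLeffler (σ := θ ^ (-1 / α)) hα0 hD
    exact ⟨Q, hQ, fun b hb => ReturnTimes.tendsto_scaledReturnLaw hX hT hT0 hW0 hXW hstat hθ0 hθ1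
      hθ hWindep hWident hα0 hWtail hQ hb⟩
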